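/- **Setting.** Let $Z=\{(x_1,y_1),\dots,(x_N,y_N)\}$, $N\ge 1$, be a finite labelled data set with $x_i\in\mathbb R^d$, $\|x_i\|\le R$ (Euclidean norm), and labels with $|y_i|\le 1$ (e.g. $y_i\in\{-1,1\}$ or $y_i\in\{0,1\}$). Let $A\subseteq Z$ satisfy $|A|\ge p_0N$ for a fixed $p_0>0$. Let $\hat Z$ be a sample of $b\ge 1$ elements of $Z$, drawn uniformly, either i.i.d. or without replacement (in the latter case $b\le N$), and let $\hat A=A\cap\hat Z$ be the family of those draws that lie in $A$ (data points and draws are counted with multiplicity). Consider the linear models $f(x)=w^Tx$ with $w\in\mathbb R^d$, $\|w\|\le C$, and let $l:\mathbb R\to\mathbb R$ be locally Lipschitz (e.g. the logistic loss or the hinge loss). For a finite family $S$ of $n$ real numbers with order statistics $s_{(1)}\le\dots\le s_{(n)}$, let $\hat q(S)$ be one of the following estimators. 1. The kernel quantile estimator $$\hat q(S)=\frac1n\sum_{i=1}^n\varphi_h\!\left(\frac{i^*}{n}-c\right)s_{(i)},\qquad \varphi_h(t)=\frac1h\,\varphi\!\left(\frac th\right),\qquad i^*=\max\{j:\ s_{(j)}=s_{(i)}\},$$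 where $c\in\mathbb R$, $h>0$ and $\varphi:\mathbb R\to\mathbb R$ is bounded and Lipschitz (in particular, $\varphi$ may be any symmetric normalized kernel with these two properties). 2. The interval quantile estimator $$\hat q(S)=\left|\frac{1}{\lfloor n(k_2-k_1)\rfloor}\sum_{i=\lfloor nk_1\rfloor}^{\lfloor nk_2\rfloor}s_{(i)}\right|,\qquad 0<k_1<k_2\le 1.$$ In this case $b\le N$ is assumed also for i.i.d. sampling. Degenerate expressions are read as follows: $\hat q(\emptyset)=0$; the interval estimator is $0$ if $\lfloor n(k_2-k_1)\rfloor=0$; and $s_{(0)}=0$. Define the normalized quantile surrogate losses $$L(w;Z,A)=\frac1N\sum_{i=1}^N(1-y_i)\,l\big(f(x_i)-\hat q(f(A))\big),\qquad L(w;\hat Z,\hat A)=\frac1b\sum_{(x,y)\in\hat Z}(1-y)\,l\big(f(x)-\hat q(f(\hat A))\big),$$ where $f(A)$ and $f(\hat A)$ are the families of scores on $A$ and $\hat A$. **Claim.** For every $\delta_0<1$ there is a constant $K$, depending only on $d,C,R,p_0,\delta_0$, on $l$, and on the estimator ($\varphi,h,c$, respectively $k_1,k_2$), but not on $N$, $b$,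 $Z$, $A$, $\delta$ or the sampling scheme, such that for every $0<\delta\le\delta_0$, with probability at least $1-\delta$, $$\big|L(w;Z,A)-L(w;\hat Z,\hat A)\big|\le K\sqrt{\frac1b\log\frac1\delta}\qquad\text{for all } w\in\mathbb R^d\text{ with }\|w\|\le C .$$ -/

import Mathlib

open MeasureTheory ProbabilityTheory

noncomputable section

namespace QuantileLoss

/-- The `i`-th order statistic `s_(i)` of a finite family of reals (counted with multiplicity),
for `1 ≤ i ≤ card S`; it is set to `0` for `i` outside this range. -/
def orderStat (S : Multiset ℝ) (i : ℕ) : ℝ :=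
  if 1 ≤ i then (S.sort (· ≤ ·)).getD (i - 1) 0 else 0

/-- The tie-breaking index `i* = max {j : s_(j) = s_(i)}`, with `j` ranging over `1, …, card S`. -/
def lastTie (S : Multiset ℝ) (i : ℕ) : ℕ :=
  ((Finset.Icc 1 S.card).filter fun j => orderStat S j = orderStat S i).sup id

/-- The rescaled kernel `φ_h(t) = φ(t / h) / h`. -/
def scaledKernel (φ : ℝ → ℝ) (h t : ℝ) : ℝ := (1 / h) * φ (t / h)

/-- The kernel quantile estimator at level `c`:
`(1/n) ∑_{i=1}^n φ_h(i*/n - c) s_(i)` with `n = card S`. It is `0` for the empty family. -/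
def kernelEstimator (φ : ℝ → ℝ) (h c : ℝ) (S : Multiset ℝ) : ℝ :=
  (1 / (S.card : ℝ)) * ∑ i ∈ Finset.Icc 1 S.card,
    scaledKernel φ h ((lastTie S i : ℝ) / (S.card : ℝ) - c) * orderStat S i

/-- The interval quantile estimator
`|(1/⌊n (k₂ - k₁)⌋) ∑_{i=⌊n k₁⌋}^{⌊n k₂⌋} s_(i)|` with `n = card S`.
It is `0` when `⌊n (k₂ - k₁)⌋ = 0`, and an index `i = 0` contributes `0` to the sum. -/
def intervalEstimator (k₁ k₂ : ℝ) (S : Multiset ℝ) : ℝ :=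
  |(1 / (⌊(S.card : ℝ) * (k₂ - k₁)⌋₊ : ℝ)) *
    ∑ i ∈ Finset.Icc ⌊(S.card : ℝ) * k₁⌋₊ ⌊(S.card : ℝ) * k₂⌋₊, orderStat S i|

/-- The quantile surrogate loss of the linear model `f(x) = wᵀ x` on the labelled data
`(x i, y i)`, `i < n`, per data point:
`(1/n) ∑ i, (1 - y i) l(f(x i) - q(f(A)))`,
where `q` is the quantile estimator, `A` is a set of indices of data points and `f(A)` is the family
of their scores. -/
def loss {d n : ℕ} (q : Multiset ℝ → ℝ) (l : ℝ → ℝ)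
    (x : Fin n → EuclideanSpace ℝ (Fin d)) (y : Fin n → ℝ) (A : Finset (Fin n))
    (w : EuclideanSpace ℝ (Fin d)) : ℝ :=
  (1 / (n : ℝ)) * ∑ i, (1 - y i) * l (inner ℝ w (x i) - q (A.val.map fun j => inner ℝ w (x j)))

/-- Law of the indices of `b` independent uniform draws from `N` data points. -/
def iidLaw (N b : ℕ) : Measure (Fin b → Fin N) :=
  Measure.pi fun _ => uniformOn Set.univ

/-- Law of the indices of `b` draws without replacement from `N` data points: all tuples of
`b` distinct indices are equally likely. -/
def noReplacementLaw (N b : ℕ) : Measure (Fin b → Fin N) :=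
  uniformOn {σ | Function.Injective σ}

/-- `P` is the law of a sample of size `b` from `N` data points, drawn either i.i.d. or without
replacement (the latter being possible only if `b ≤ N`). -/
def IsSampleLaw {N b : ℕ} (P : Measure (Fin b → Fin N)) : Prop :=
  P = iidLaw N b ∨ (b ≤ N ∧ P = noReplacementLaw N b)

/-- The sample loss `L(w; Ẑ, Â)`: the sample `Ẑ` is `(x (σ j), y (σ j))`, `j < b`, and `Â` consists
of the draws that fall into `A`. -/
def sampleLoss {d N b : ℕ} (q : Multiset ℝ → ℝ) (l : ℝ → ℝ)
    (x : Fin N → EuclideanSpace ℝ (Fin d)) (y : Fin N → ℝ) (A : Finset (Fin N))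
    (σ : Fin b → Fin N) (w : EuclideanSpace ℝ (Fin d)) : ℝ :=
  loss q l (x ∘ σ) (y ∘ σ) (Finset.univ.filter fun j => σ j ∈ A) w

/-- The samples for which the full-data loss and the sample loss differ by at most `ε`, uniformly
over all parameters `w` with `‖w‖ ≤ C`. -/
def closeEvent {d N : ℕ} (b : ℕ) (q : Multiset ℝ → ℝ) (l : ℝ → ℝ)
    (x : Fin N → EuclideanSpace ℝ (Fin d)) (y : Fin N → ℝ) (A : Finset (Fin N))
    (C ε : ℝ) : Set (Fin b → Fin N) :=
  {σ | ∀ w : EuclideanSpace ℝ (Fin d), ‖w‖ ≤ C →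
    |loss q l x y A w - sampleLoss q l x y A σ w| ≤ ε}

end QuantileLoss

end

/-! The theorem splits into a probabilistic and a deterministic half, joined by one quantity: the
difference between the sample mass and the population mass of a half-space `{wᵀx ≤ t}`, for the
weights `1_A` and `1 - y` (`massGap`).

Probabilistic half. Half-spaces have VC dimension at most `d + 1`, so the logarithm of their
covering numbers at normalized Hamming scale `4⁻ᵏ` grows only linearly in `k` (`exists_net`).
Chaining (`expect_exp_le_of_chaining`) then controls exponential moments of the supremum over all
half-spaces without a factor `log b`. Symmetrization passes from i.i.d. draws to Rademacher sums
over `2b` fixed points, and Hoeffding's comparison passes from sampling without replacement to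
i.i.d. sampling. Both use only convexity: the supremum over half-spaces is the sup norm of a sum of
the vectors `centeredTrace`, and `exp (μ ‖·‖)` is convex. A Chernoff bound gives
`exists_card_massGap_le`.

Deterministic half. By Abel summation, close half-space masses give close integrals of any function
of bounded variation of the score. Both estimators are therefore stable in the empirical
distribution function (`IsStable`). The kernel estimator is a mean of such a function, because
`i*/n` is the empirical distribution function at `s_(i)`. The interval estimator is, up to rounding,
a difference of sums of smallest scores, and such a sum is the maximum over `t` of `m t - ∑ (t -
s)₊`. Replacing first the measure and then the threshold in the loss yields
`abs_loss_sub_sampleLoss_le`. Rounding errors of order `1/b` are absorbed into the rate since `log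
(1/δ)` stays away from `0` for `δ ≤ δ₀ < 1`. -/

namespace QuantileLoss

open scoped BigOperators

/-! ### Half-spaces: VC dimension and metric entropy -/

open Finset in
open scoped Classical in
/-- The traces of closed half-spaces on a finite family of points. -/
noncomputable def halfTraces {d : ℕ} {ι : Type*} [Fintype ι] (x : ι → EuclideanSpace ℝ (Fin d)) :
    Finset (Finset ι) :=
  univ.filter fun H => ∃ (w : EuclideanSpace ℝ (Fin d)) (t : ℝ), ∀ i, i ∈ H ↔ inner ℝ w (x i) ≤ t

lemma mem_halfTraces {d : ℕ} {ι : Type*} [Fintype ι] {x : ι → EuclideanSpace ℝ (Fin d)}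
    {H : Finset ι} : H ∈ halfTraces x ↔
      ∃ (w : EuclideanSpace ℝ (Fin d)) (t : ℝ), ∀ i, i ∈ H ↔ inner ℝ w (x i) ≤ t := by
  simp [halfTraces]

/-- Half-spaces in dimension `d` shatter no more than `d + 1` points. -/
lemma card_le_of_shatters_halfTraces {d : ℕ} {ι : Type*} [Fintype ι] [DecidableEq ι]
    (x : ι → EuclideanSpace ℝ (Fin d)) {s : Finset ι} (hs : (halfTraces x).Shatters s) :
    s.card ≤ d + 1 := by
  by_contra hcard
  have hdep : ¬ AffineIndependent ℝ (fun i : s => x i) := by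
    rw [← finrank_vectorSpan_le_iff_not_affineIndependent ℝ _ (n := s.card - 2)
      (by simp only [Fintype.card_coe]; omega)]
    refine (Submodule.finrank_le _).trans ?_
    simp only [finrank_euclideanSpace, Fintype.card_fin]
    omega
  -- More than `d + 1` points have a Radon partition; a half-space cutting out exactly one part
  -- would separate the two hulls, which share `p`.
  obtain ⟨I, p, hpI, hpJ⟩ := Convex.radon_partition hdep
  classical
  obtain ⟨H, hH, hsH⟩ := hs (t := s.filter fun i => ∃ h : i ∈ s, (⟨i, h⟩ : s) ∈ I)
    (Finset.filter_subset _ _)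
  obtain ⟨w, t, hwt⟩ := mem_halfTraces.1 hH
  have hiff : ∀ i : s, i ∈ I ↔ inner ℝ w (x i) ≤ t := by
    intro i
    rw [← hwt]
    have := Finset.ext_iff.1 hsH i
    simp only [Finset.mem_inter, Finset.mem_filter, Finset.coe_mem, true_and, exists_true_left]
      at this
    exact this.symm
  have h1 : p ∈ {z | inner ℝ w z ≤ t} := by
    refine convexHull_min ?_ (convex_halfSpace_le (innerSL ℝ w).toLinearMap.isLinear t) hpI
    rintro _ ⟨i, hi, rfl⟩
    exact (hiff i).1 hi
  have h2 : p ∈ {z | t < inner ℝ w z} := by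
    refine convexHull_min ?_ (convex_halfSpace_gt (innerSL ℝ w).toLinearMap.isLinear t) hpJ
    rintro _ ⟨i, hi, rfl⟩
    exact not_le.1 fun h => hi ((hiff i).2 h)
  exact absurd (show inner ℝ w p ≤ t from h1) (not_le.2 h2)

/-- Sauer–Shelah, with the sum of binomial coefficients dominated termwise by the binomial expansion
of `(n + 1) ^ (d + 1)`. -/
lemma card_halfTraces_le {d : ℕ} {ι : Type*} [Fintype ι] (x : ι → EuclideanSpace ℝ (Fin d)) :
    (halfTraces x).card ≤ (Fintype.card ι + 1) ^ (d + 1) := by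
  classical
  have hvc : (halfTraces x).vcDim ≤ d + 1 :=
    Finset.sup_le fun s hs => card_le_of_shatters_halfTraces x (Finset.mem_shatterer.1 hs)
  calc (halfTraces x).card ≤ (halfTraces x).shatterer.card := Finset.card_le_card_shatterer _
    _ ≤ ∑ k ∈ Finset.Iic (halfTraces x).vcDim, (Fintype.card ι).choose k :=
      Finset.card_shatterer_le_sum_vcDim
    _ ≤ ∑ k ∈ Finset.range (d + 1 + 1), (Fintype.card ι).choose k :=
      Finset.sum_le_sum_of_subset fun k hk => by
        simp only [Finset.mem_Iic, Finset.mem_range] at hk ⊢; omega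
    _ ≤ ∑ k ∈ Finset.range (d + 1 + 1),
          Fintype.card ι ^ k * 1 ^ (d + 1 - k) * (d + 1).choose k := by
      refine Finset.sum_le_sum fun k hk => ?_
      rw [one_pow, mul_one]
      exact (Nat.choose_le_pow _ _).trans (Nat.le_mul_of_pos_right _
        (Nat.choose_pos (by simpa [Nat.lt_succ_iff] using hk)))
    _ = (Fintype.card ι + 1) ^ (d + 1) := (add_pow _ _ _).symm

/-- A family of subsets with pairwise large symmetric differences is separated by a short
tuple of points. -/
lemma exists_separating_tuple {ι : Type*} [Fintype ι] [DecidableEq ι] [Nonempty ι]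
    (𝒮 : Finset (Finset ι)) {ε : ℝ} (m : ℕ)
    (hsep : ∀ H ∈ 𝒮, ∀ H' ∈ 𝒮, H ≠ H' → ε * Fintype.card ι ≤ (symmDiff H H').card)
    (hm : (𝒮.card : ℝ) ^ 2 * (1 - ε) ^ m < 1) :
    ∃ τ : Fin m → ι, ∀ H ∈ 𝒮, ∀ H' ∈ 𝒮, H ≠ H' → ∃ j, τ j ∈ symmDiff H H' := by
  by_contra! hcon
  have hn : (0 : ℝ) < Fintype.card ι := by exact_mod_cast Fintype.card_pos
  -- Counting form of the probabilistic method: if every tuple misses some symmetric difference, the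
  -- missing tuples of all pairs exhaust the whole space.
  have hcover : (Finset.univ : Finset (Fin m → ι)) ⊆
      𝒮.offDiag.biUnion fun q => Fintype.piFinset fun _ => (symmDiff q.1 q.2)ᶜ := by
    intro τ _
    obtain ⟨H, hH, H', hH', hne, hτ⟩ := hcon τ
    simp only [Finset.mem_biUnion, Finset.mem_offDiag, Fintype.mem_piFinset, Finset.mem_compl]
    exact ⟨(H, H'), ⟨hH, hH', hne⟩, hτ⟩
  have h1 : (Fintype.card ι : ℝ) ^ m ≤ (𝒮.card : ℝ) ^ 2 * ((1 - ε) * Fintype.card ι) ^ m := by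
    have h2 := (Finset.card_le_card hcover).trans Finset.card_biUnion_le
    rw [Finset.card_univ, Fintype.card_fun, Fintype.card_fin] at h2
    have h3 : ((Fintype.card ι ^ m : ℕ) : ℝ) ≤
        ∑ q ∈ 𝒮.offDiag, ((1 - ε) * Fintype.card ι) ^ m := by
      refine (Nat.cast_le.2 h2).trans ?_
      rw [Nat.cast_sum]
      refine Finset.sum_le_sum fun q hq => ?_
      obtain ⟨hq1, hq2, hne⟩ := Finset.mem_offDiag.1 hq
      rw [Fintype.card_piFinset, Finset.prod_const, Finset.card_univ, Fintype.card_fin,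
        Finset.card_compl, Nat.cast_pow, Nat.cast_sub (Finset.card_le_univ _)]
      refine pow_le_pow_left₀ (sub_nonneg.2 (by exact_mod_cast Finset.card_le_univ _)) ?_ m
      linarith [hsep _ hq1 _ hq2 hne]
    rw [Nat.cast_pow] at h3
    have h4 : ∑ q ∈ 𝒮.offDiag, ((1 - ε) * (Fintype.card ι : ℝ)) ^ m
        = (𝒮.offDiag.card : ℝ) * ((1 - ε) * (Fintype.card ι : ℝ)) ^ m := by
      rw [Finset.sum_const, nsmul_eq_mul]
    rw [h4] at h3
    refine h3.trans ?_
    -- `ε ≤ 1` is not assumed; nonnegativity of `1 - ε` comes from the existence of a separated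
    -- pair, and without such a pair `h3` is already absurd.
    by_cases hemp : 𝒮.offDiag = ∅
    · exfalso
      rw [hemp] at h3
      have : (0 : ℝ) < (Fintype.card ι : ℝ) ^ m := by positivity
      simp at h3
      linarith
    · obtain ⟨q, hq⟩ := Finset.nonempty_iff_ne_empty.2 hemp
      obtain ⟨hq1, hq2, hne⟩ := Finset.mem_offDiag.1 hq
      have hle : ((symmDiff q.1 q.2).card : ℝ) ≤ Fintype.card ι := by
        exact_mod_cast Finset.card_le_univ _
      have hnn : 0 ≤ (1 - ε) * (Fintype.card ι : ℝ) := by linarith [hsep _ hq1 _ hq2 hne]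
      refine mul_le_mul_of_nonneg_right ?_ (pow_nonneg hnn m)
      rw [Finset.offDiag_card, sq]
      exact_mod_cast Nat.sub_le _ _
  rw [mul_pow, ← mul_assoc] at h1
  have h5 : (0 : ℝ) < (Fintype.card ι : ℝ) ^ m := by positivity
  nlinarith

/-- Restriction to a separating tuple is injective on `𝒮`, so Sauer–Shelah applies to `m` points
instead of all of `ι`: the bound does not involve the size of the ground set. -/
lemma card_packing_le {d : ℕ} {ι : Type*} [Fintype ι] [DecidableEq ι] [Nonempty ι]
    (x : ι → EuclideanSpace ℝ (Fin d)) {𝒮 : Finset (Finset ι)} (h𝒮 : 𝒮 ⊆ halfTraces x)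
    {ε : ℝ} (m : ℕ)
    (hsep : ∀ H ∈ 𝒮, ∀ H' ∈ 𝒮, H ≠ H' → ε * Fintype.card ι ≤ (symmDiff H H').card)
    (hm : (𝒮.card : ℝ) ^ 2 * (1 - ε) ^ m < 1) :
    𝒮.card ≤ (m + 1) ^ (d + 1) := by
  obtain ⟨τ, hτ⟩ := exists_separating_tuple 𝒮 m hsep hm
  have := card_halfTraces_le (x ∘ τ)
  rw [Fintype.card_fin] at this
  refine le_trans ?_ this
  refine Finset.card_le_card_of_injOn (fun H => Finset.univ.filter fun j => τ j ∈ H) ?_ ?_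
  · intro H hH
    obtain ⟨w, t, hwt⟩ := mem_halfTraces.1 (h𝒮 hH)
    exact mem_halfTraces.2 ⟨w, t, fun j => by simp [hwt]⟩
  · intro H hH H' hH' heq
    by_contra hne
    obtain ⟨j, hj⟩ := hτ H hH H' hH' hne
    have := Finset.ext_iff.1 heq j
    simp only [Finset.mem_filter, Finset.mem_univ, true_and] at this
    rw [Finset.mem_symmDiff] at hj
    tauto

/-- Metric entropy of half-spaces in the normalized Hamming distance. -/
lemma log_card_packing_le {d : ℕ} {ι : Type*} [Fintype ι] [DecidableEq ι] [Nonempty ι]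
    (x : ι → EuclideanSpace ℝ (Fin d)) {𝒮 : Finset (Finset ι)} (h𝒮 : 𝒮 ⊆ halfTraces x)
    {ε : ℝ} (hε : 0 < ε) (hε1 : ε ≤ 1)
    (hsep : ∀ H ∈ 𝒮, ∀ H' ∈ 𝒮, H ≠ H' → ε * Fintype.card ι ≤ (symmDiff H H').card) :
    Real.log 𝒮.card ≤
      2 * (d + 1) * Real.log (2 / ε) + 2 * (d + 1) * Real.log (2 * (d + 1)) + 1 := by
  have hD : (1 : ℝ) ≤ d + 1 := by linarith [(Nat.cast_nonneg d : (0 : ℝ) ≤ d)]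
  have hl1 : 0 ≤ Real.log (2 / ε) := Real.log_nonneg (by rw [le_div_iff₀ hε]; linarith)
  have hl2 : 0 ≤ Real.log (2 * ((d : ℝ) + 1)) := Real.log_nonneg (by linarith)
  rcases 𝒮.eq_empty_or_nonempty with rfl | hne
  · simp only [Finset.card_empty, Nat.cast_zero, Real.log_zero]
    positivity
  have hMpos : (0 : ℝ) < 𝒮.card := by exact_mod_cast hne.card_pos
  have hM1 : (1 : ℝ) ≤ 𝒮.card := by exact_mod_cast hne.card_pos
  set L := Real.log 𝒮.card with hL
  have hL0 : 0 ≤ L := Real.log_nonneg hM1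
  -- Just long enough for `exp (2L) (1 - ε) ^ m < 1`. Since `m` depends on `L`, the resulting bound
  -- on `L` is implicit.
  set m := ⌊2 * L / ε⌋₊ + 1 with hm
  have hm1 : 2 * L / ε < m := by rw [hm]; exact_mod_cast Nat.lt_floor_add_one _
  have hm2 : (m : ℝ) ≤ 2 * L / ε + 1 := by
    rw [hm]; push_cast; linarith [Nat.floor_le (show 0 ≤ 2 * L / ε by positivity)]
  have hcard := card_packing_le x h𝒮 m hsep (by
    have h1 : (1 - ε) ^ m ≤ Real.exp (-(ε * m)) := by
      calc (1 - ε) ^ m ≤ (Real.exp (-ε)) ^ m :=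
            pow_le_pow_left₀ (by linarith) (by linarith [Real.add_one_le_exp (-ε)]) m
        _ = Real.exp (-(ε * m)) := by rw [← Real.exp_nat_mul]; ring_nf
    have h2 : (𝒮.card : ℝ) ^ 2 = Real.exp (2 * L) := by
      rw [hL, mul_comm, Real.exp_mul, Real.exp_log hMpos]; norm_cast
    calc (𝒮.card : ℝ) ^ 2 * (1 - ε) ^ m ≤ Real.exp (2 * L) * Real.exp (-(ε * m)) := by
          rw [h2]; gcongr
      _ = Real.exp (2 * L - ε * m) := by rw [← Real.exp_add]; ring_nf
      _ < 1 := by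
        rw [Real.exp_lt_one_iff]
        rw [div_lt_iff₀ hε] at hm1
        linarith)
  have h1 : L ≤ (d + 1) * Real.log (m + 1) := by
    have : (𝒮.card : ℝ) ≤ ((m : ℝ) + 1) ^ (d + 1) := by exact_mod_cast hcard
    calc L ≤ Real.log (((m : ℝ) + 1) ^ (d + 1)) := Real.log_le_log hMpos this
      _ = _ := by rw [Real.log_pow]; push_cast; ring
  have h2 : Real.log (m + 1) ≤ Real.log (2 / ε) + Real.log (1 + L) := by
    rw [← Real.log_mul (by positivity) (by positivity)]
    refine Real.log_le_log (by positivity) ?_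
    have : 2 ≤ 2 / ε := by rw [le_div_iff₀ hε]; linarith
    calc (m : ℝ) + 1 ≤ 2 + 2 * L / ε := by linarith
      _ ≤ 2 / ε + 2 * L / ε := by linarith
      _ = 2 / ε * (1 + L) := by ring
  -- The tangent to `log` at `2(d + 1)`: after multiplication by `d + 1` it contributes only `L /
  -- 2`, which the left side absorbs.
  have h3 : Real.log (1 + L) ≤ (1 + L) / (2 * (d + 1)) - 1 + Real.log (2 * (d + 1)) := by
    have := Real.log_le_sub_one_of_pos (show 0 < (1 + L) / (2 * ((d : ℝ) + 1)) by positivity)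
    rw [Real.log_div (by positivity) (by positivity)] at this
    linarith
  have h4 : ((d : ℝ) + 1) * Real.log (m + 1) ≤ (d + 1) * (Real.log (2 / ε) +
      ((1 + L) / (2 * (d + 1)) - 1 + Real.log (2 * (d + 1)))) := by
    gcongr; linarith
  have h5 : ((d : ℝ) + 1) * ((1 + L) / (2 * (d + 1))) = (1 + L) / 2 := by
    field_simp
  nlinarith

/-- The traces of half-spaces have nets of size `exp (a (k + 1))` at scale `4⁻ᵏ`. -/
lemma exists_net (d : ℕ) : ∃ a : ℝ, 0 ≤ a ∧ ∀ {ι : Type} [Fintype ι] [DecidableEq ι] [Nonempty ι]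
    (x : ι → EuclideanSpace ℝ (Fin d)) (k : ℕ), ∃ 𝒩 : Finset (Finset ι),
      Real.log 𝒩.card ≤ a * (k + 1) ∧
      ∀ H ∈ halfTraces x, ∃ H' ∈ 𝒩, ((symmDiff H H').card : ℝ) ≤ (1 / 4) ^ k * Fintype.card ι := by
  have hD : (1 : ℝ) ≤ d + 1 := by linarith [(Nat.cast_nonneg d : (0 : ℝ) ≤ d)]
  have hl2 : 0 ≤ Real.log (2 * ((d : ℝ) + 1)) := Real.log_nonneg (by linarith)
  have hl4 : 0 ≤ Real.log 4 := Real.log_nonneg (by norm_num)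
  have hl24 : Real.log 2 ≤ Real.log 4 := Real.log_le_log (by norm_num) (by norm_num)
  refine ⟨2 * (d + 1) * Real.log 4 + 2 * (d + 1) * Real.log (2 * (d + 1)) + 1, by positivity, ?_⟩
  intro ι _ _ _ x k
  classical
  let P : Finset (Finset ι) → Prop := fun 𝒮 => ∀ H ∈ 𝒮, ∀ H' ∈ 𝒮, H ≠ H' →
    (1 / 4) ^ k * (Fintype.card ι : ℝ) ≤ (symmDiff H H').card
  -- A packing of maximal size is a net: a trace far from all its members could be added.
  obtain ⟨𝒩, h𝒩, hmax⟩ := Finset.exists_max_image ((halfTraces x).powerset.filter P)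
    Finset.card ⟨∅, by simp [P]⟩
  rw [Finset.mem_filter, Finset.mem_powerset] at h𝒩
  refine ⟨𝒩, ?_, fun H hH => ?_⟩
  · refine (log_card_packing_le x h𝒩.1 (ε := (1 / 4) ^ k) (by positivity)
      (pow_le_one₀ (by norm_num) (by norm_num)) h𝒩.2).trans ?_
    have : Real.log (2 / (1 / 4) ^ k) = Real.log 2 + k * Real.log 4 := by
      rw [one_div, inv_pow, div_inv_eq_mul, Real.log_mul (by norm_num) (by positivity),
        Real.log_pow]
    rw [this]
    have hk : (0 : ℝ) ≤ k := Nat.cast_nonneg k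
    have e1 : 2 * ((d : ℝ) + 1) * (Real.log 2 + k * Real.log 4) ≤
      2 * ((d : ℝ) + 1) * (Real.log 4 + k * Real.log 4) := by gcongr
    have e2 : 0 ≤ 2 * ((d : ℝ) + 1) * Real.log (2 * (d + 1)) * k := by positivity
    nlinarith
  · by_contra! hfar
    have hnot : H ∉ 𝒩 := fun h => by
      have := hfar H h
      simp only [symmDiff_self, Finset.bot_eq_empty, Finset.card_empty, Nat.cast_zero] at this
      exact absurd this (not_lt.2 (by positivity))
    have := hmax (insert H 𝒩) (by
      rw [Finset.mem_filter, Finset.mem_powerset]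
      refine ⟨Finset.insert_subset hH h𝒩.1, ?_⟩
      intro H₁ h₁ H₂ h₂ hne
      rcases Finset.mem_insert.1 h₁ with rfl | h₁' <;> rcases Finset.mem_insert.1 h₂ with rfl | h₂'
      · exact absurd rfl hne
      · exact (hfar _ h₂').le
      · rw [symmDiff_comm]; exact (hfar _ h₁').le
      · exact h𝒩.2 _ h₁' _ h₂' hne)
    rw [Finset.card_insert_of_notMem hnot] at this
    omega

/-! ### Chaining -/

lemma half_pow_add_sum (K : ℕ) :
    (1 / 2 : ℝ) ^ K + ∑ k ∈ Finset.range K, (1 / 2 : ℝ) ^ (k + 1) = 1 := by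
  induction K with
  | zero => simp
  | succ K ih => rw [Finset.sum_range_succ, pow_succ]; linarith

/-- Jensen with weights `2^{-(k+1)}`; the leftover mass `2^{-K}` sits at the point `0`. -/
lemma exp_sum_half_pow_le (K : ℕ) (z : ℕ → ℝ) :
    Real.exp (∑ k ∈ Finset.range K, (1 / 2) ^ (k + 1) * z k) ≤
      (1 / 2) ^ K + ∑ k ∈ Finset.range K, (1 / 2) ^ (k + 1) * Real.exp (z k) := by
  have := convexOn_exp.map_add_sum_le (t := Finset.range K) (w := fun k => (1 / 2 : ℝ) ^ (k + 1))
    (p := z) (v := (1 / 2 : ℝ) ^ K) (q := 0) (fun _ _ => by positivity)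
    (half_pow_add_sum K)
    (fun _ _ => Set.mem_univ _) (by positivity) (Set.mem_univ _)
  simpa using this

lemma sum_half_pow_mul_le {a b : ℝ} (ha : 0 ≤ a) (hb : 0 ≤ b) (K : ℕ) :
    ∑ k ∈ Finset.range K, (1 / 2 : ℝ) ^ (k + 1) * (a * (2 * k + 3) + b) ≤ 5 * a + b := by
  have : ∑ k ∈ Finset.range K, (1 / 2 : ℝ) ^ (k + 1) * (a * (2 * k + 3) + b) =
      5 * a + b - (a * (2 * K + 5) + b) * (1 / 2) ^ K := by
    induction K with
    | zero => simp; ring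
    | succ K ih => rw [Finset.sum_range_succ, ih]; push_cast; ring
  rw [this]
  have : 0 ≤ (a * (2 * K + 5) + b) * (1 / 2 : ℝ) ^ K := by positivity
  linarith

/-- Dudley's chaining bound, in exponential form, for a process with subgaussian increments
indexed by subsets whose entropy grows linearly in the logarithm of the scale. -/
lemma expect_exp_le_of_chaining {Ω ι : Type*} [Fintype Ω] [Nonempty Ω] [Fintype ι] [DecidableEq ι]
    (𝒯 : Finset (Finset ι)) (X : Finset ι → Ω → ℝ) {s a : ℝ} (hs : 0 ≤ s) (ha : 0 ≤ a)
    (hX0 : ∀ ω, X ∅ ω = 0)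
    (hsub : ∀ H H' μ, 𝔼 ω, Real.exp (μ * (X H ω - X H' ω)) ≤
      Real.exp (μ ^ 2 * s * (symmDiff H H').card))
    (hnet : ∀ k : ℕ, ∃ 𝒩 : Finset (Finset ι), Real.log 𝒩.card ≤ a * (k + 1) ∧
      ∀ H ∈ 𝒯, ∃ H' ∈ 𝒩, ((symmDiff H H').card : ℝ) ≤ (1 / 4) ^ k * Fintype.card ι)
    (Y : Ω → ℝ) (hY : ∀ ω, ∃ H ∈ 𝒯, Y ω ≤ |X H ω|) {μ : ℝ} (hμ : 0 ≤ μ) :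
    𝔼 ω, Real.exp (μ * Y ω) ≤
      Real.exp (5 * a + Real.log 2 + 8 * μ ^ 2 * s * Fintype.card ι) := by
  set n : ℝ := (Fintype.card ι : ℝ) with hn
  have hn0 : 0 ≤ n := Nat.cast_nonneg _
  -- At scale `1` the single set `∅` is a net, so every chain can start where `X` vanishes.
  obtain ⟨𝒩, h𝒩0, h𝒩card, h𝒩⟩ : ∃ 𝒩 : ℕ → Finset (Finset ι), 𝒩 0 = {∅} ∧
      (∀ k, Real.log (𝒩 k).card ≤ a * (k + 1)) ∧
      ∀ k, ∀ H, ∃ H', H ∈ 𝒯 → H' ∈ 𝒩 k ∧ ((symmDiff H H').card : ℝ) ≤ (1 / 4) ^ k * n := by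
    choose 𝒩 h1 h2 using hnet
    refine ⟨fun k => if k = 0 then {∅} else 𝒩 k, by simp, fun k => ?_, fun k H => ?_⟩
    · rcases eq_or_ne k 0 with rfl | hk
      · simpa using ha
      · simpa [hk] using h1 k
    · by_cases hH : H ∈ 𝒯
      swap
      · exact ⟨∅, fun h => absurd h hH⟩
      rcases eq_or_ne k 0 with rfl | hk
      · refine ⟨∅, fun _ => ⟨by simp, ?_⟩⟩
        rw [pow_zero, one_mul, hn]
        exact_mod_cast Finset.card_le_univ _
      · obtain ⟨H', h3, h4⟩ := h2 k H hH
        exact ⟨H', fun _ => ⟨by simpa [hk] using h3, h4⟩⟩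
  choose π hπ using h𝒩
  -- Below distance `1` the approximation is exact, so the chains are finite.
  obtain ⟨K, hK⟩ : ∃ K : ℕ, (1 / 4 : ℝ) ^ K * n < 1 := by
    obtain ⟨K, hK⟩ := exists_pow_lt_of_lt_one (show 0 < 1 / (n + 1) by positivity)
      (show (1 / 4 : ℝ) < 1 by norm_num)
    refine ⟨K, ?_⟩
    rw [lt_div_iff₀ (by positivity)] at hK
    have : (0 : ℝ) < (1 / 4) ^ K := by positivity
    nlinarith
  have hπ0 : ∀ H ∈ 𝒯, π 0 H = ∅ := fun H hH => by
    have := (hπ 0 H hH).1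
    rwa [h𝒩0, Finset.mem_singleton] at this
  have hπK : ∀ H ∈ 𝒯, π K H = H := fun H hH => by
    have h1 : ((symmDiff H (π K H)).card : ℝ) < 1 := (hπ K H hH).2.trans_lt hK
    have h2 : (symmDiff H (π K H)).card = 0 := by
      have : (symmDiff H (π K H)).card < 1 := by exact_mod_cast h1
      omega
    rw [Finset.card_eq_zero] at h2
    exact (symmDiff_eq_bot.1 h2).symm
  let links : ℕ → Finset (Finset ι × Finset ι) := fun k =>
    ((𝒩 (k + 1)) ×ˢ (𝒩 k)).filter fun q =>
      ((symmDiff q.1 q.2).card : ℝ) ≤ 2 * (1 / 4) ^ k * n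
  -- An upper bound for `log (2 * #links k)`: the entropies at levels `k + 1` and `k` add to `a (2k
  -- + 3)`, and the factor `2` pays for the absolute value. Its average with weights `2^{-(k+1)}` is
  -- at most `5a + log 2`.
  let L : ℕ → ℝ := fun k => a * (2 * k + 3) + Real.log 2
  have hlinks : ∀ k, ∀ H ∈ 𝒯, (π (k + 1) H, π k H) ∈ links k := by
    intro k H hH
    simp only [links, Finset.mem_filter, Finset.mem_product]
    refine ⟨⟨(hπ _ H hH).1, (hπ _ H hH).1⟩, ?_⟩
    have h1 := (hπ (k + 1) H hH).2
    have h2 := (hπ k H hH).2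
    have h3 : (symmDiff (π (k + 1) H) (π k H)).card ≤
        (symmDiff H (π (k + 1) H)).card + (symmDiff H (π k H)).card := by
      refine (Finset.card_le_card (t := symmDiff H (π (k + 1) H) ∪ symmDiff H (π k H)) ?_).trans
        (Finset.card_union_le _ _)
      have := symmDiff_triangle (π (k + 1) H) H (π k H)
      rwa [symmDiff_comm (π (k + 1) H) H] at this
    have h4 : ((symmDiff (π (k + 1) H) (π k H)).card : ℝ) ≤
        (symmDiff H (π (k + 1) H)).card + (symmDiff H (π k H)).card := by exact_mod_cast h3
    have h5 : (1 / 4 : ℝ) ^ (k + 1) * n ≤ (1 / 4) ^ k * n := by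
      refine mul_le_mul_of_nonneg_right ?_ hn0
      exact pow_le_pow_of_le_one (by norm_num) (by norm_num) (Nat.le_succ k)
    linarith
  have hlinkcard : ∀ k, 2 * ((links k).card : ℝ) ≤ Real.exp (L k) := by
    intro k
    have h1 : ((links k).card : ℝ) ≤ (𝒩 (k + 1)).card * (𝒩 k).card := by
      have := (Finset.card_filter_le ((𝒩 (k + 1)) ×ˢ (𝒩 k)) fun q =>
        ((symmDiff q.1 q.2).card : ℝ) ≤ 2 * (1 / 4) ^ k * n)
      rw [Finset.card_product] at this
      exact_mod_cast this
    have h2 : ∀ j, ((𝒩 j).card : ℝ) ≤ Real.exp (a * (j + 1)) := fun j =>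
      (Real.le_exp_log _).trans (Real.exp_le_exp.2 (h𝒩card j))
    have h3 : ((𝒩 (k + 1)).card : ℝ) * (𝒩 k).card ≤
        Real.exp (a * ((k + 1 : ℕ) + 1)) * Real.exp (a * (k + 1)) := by
      gcongr <;> exact h2 _
    rw [← Real.exp_add] at h3
    have h4 : Real.exp (L k) = 2 * Real.exp (a * ((k + 1 : ℕ) + 1) + a * (k + 1)) := by
      simp only [L]
      rw [Real.exp_add, Real.exp_log (by norm_num), mul_comm]
      congr 2
      push_cast; ring
    rw [h4]
    linarith
  let W : ℕ → Ω → ℝ := fun k ω => ∑ q ∈ links k,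
    (Real.exp (μ * 2 ^ (k + 1) * (X q.1 ω - X q.2 ω)) +
      Real.exp (-(μ * 2 ^ (k + 1)) * (X q.1 ω - X q.2 ω)))
  set B := 5 * a + Real.log 2 with hB
  have hpoint : ∀ ω, Real.exp (μ * Y ω) ≤ Real.exp B *
      ((1 / 2) ^ K + ∑ k ∈ Finset.range K, (1 / 2) ^ (k + 1) * (Real.exp (-L k) * W k ω)) := by
    intro ω
    obtain ⟨H, hH, hYH⟩ := hY ω
    -- Increments are scaled up by the inverse Jensen weight, and the entropy cost is subtracted in
    -- advance.
    let z : ℕ → ℝ := fun k => μ * 2 ^ (k + 1) * |X (π (k + 1) H) ω - X (π k H) ω| - L k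
    have h1 : μ * |X H ω| ≤ B + ∑ k ∈ Finset.range K, (1 / 2) ^ (k + 1) * z k := by
      have h2 : X H ω = ∑ k ∈ Finset.range K, (X (π (k + 1) H) ω - X (π k H) ω) := by
        rw [Finset.sum_range_sub (fun k => X (π k H) ω), hπK H hH, hπ0 H hH, hX0, sub_zero]
      have h3 : μ * |X H ω| ≤
          ∑ k ∈ Finset.range K, μ * |X (π (k + 1) H) ω - X (π k H) ω| := by
        rw [← Finset.mul_sum, h2]
        exact mul_le_mul_of_nonneg_left (Finset.abs_sum_le_sum_abs _ _) hμ
      have h4 : ∑ k ∈ Finset.range K, (1 / 2 : ℝ) ^ (k + 1) * z k =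
          ∑ k ∈ Finset.range K, μ * |X (π (k + 1) H) ω - X (π k H) ω| -
            ∑ k ∈ Finset.range K, (1 / 2 : ℝ) ^ (k + 1) * L k := by
        rw [← Finset.sum_sub_distrib]
        refine Finset.sum_congr rfl fun k _ => ?_
        simp only [z]
        rw [mul_sub]
        congr 1
        rw [show (1 / 2 : ℝ) ^ (k + 1) = (2 ^ (k + 1))⁻¹ by rw [one_div, inv_pow]]
        field_simp
      have h5 : ∑ k ∈ Finset.range K, (1 / 2 : ℝ) ^ (k + 1) * L k ≤ B :=
        sum_half_pow_mul_le ha (Real.log_nonneg (by norm_num)) K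
      linarith
    have h6 : ∀ k, Real.exp (z k) ≤ Real.exp (-L k) * W k ω := by
      intro k
      have h7 : Real.exp (μ * 2 ^ (k + 1) * |X (π (k + 1) H) ω - X (π k H) ω|) ≤ W k ω := by
        refine le_trans ?_ (Finset.single_le_sum (f := fun q : Finset ι × Finset ι =>
          Real.exp (μ * 2 ^ (k + 1) * (X q.1 ω - X q.2 ω)) +
            Real.exp (-(μ * 2 ^ (k + 1)) * (X q.1 ω - X q.2 ω)))
          (fun q _ => by positivity) (hlinks k H hH))
        simp only
        rcases abs_cases (X (π (k + 1) H) ω - X (π k H) ω) with ⟨h, _⟩ | ⟨h, _⟩ <;> rw [h]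
        · exact le_add_of_nonneg_right (Real.exp_pos _).le
        · rw [mul_neg, ← neg_mul]
          exact le_add_of_nonneg_left (Real.exp_pos _).le
      simp only [z]
      rw [sub_eq_add_neg, Real.exp_add, mul_comm]
      exact mul_le_mul_of_nonneg_left h7 (Real.exp_pos _).le
    calc Real.exp (μ * Y ω) ≤ Real.exp (μ * |X H ω|) :=
          Real.exp_le_exp.2 (mul_le_mul_of_nonneg_left hYH hμ)
      _ ≤ Real.exp (B + ∑ k ∈ Finset.range K, (1 / 2) ^ (k + 1) * z k) := Real.exp_le_exp.2 h1
      _ = Real.exp B * Real.exp (∑ k ∈ Finset.range K, (1 / 2) ^ (k + 1) * z k) :=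
          Real.exp_add _ _
      _ ≤ _ := by
        refine mul_le_mul_of_nonneg_left ((exp_sum_half_pow_le K z).trans ?_) (Real.exp_pos _).le
        refine add_le_add le_rfl (Finset.sum_le_sum fun k _ => ?_)
        exact mul_le_mul_of_nonneg_left (h6 k) (by positivity)
  set E := Real.exp (8 * μ ^ 2 * s * n) with hE
  have hE1 : 1 ≤ E := Real.one_le_exp (by positivity)
  have hW : ∀ k, Real.exp (-L k) * 𝔼 ω, W k ω ≤ E := by
    intro k
    -- The blow-up `4^{k+1}` of the variance exactly cancels the shrinking of the links, so every
    -- level has the same bound `E`.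
    have hpow : ((2 : ℝ) ^ (k + 1)) ^ 2 * (1 / 4) ^ k = 4 := by
      rw [← pow_mul, mul_comm (k + 1) 2, pow_mul, one_div, inv_pow,
        show (2 : ℝ) ^ 2 = 4 by norm_num, pow_succ]
      field_simp
    have h1 : ∀ q ∈ links k, ∀ ν : ℝ, ν ^ 2 = (μ * 2 ^ (k + 1)) ^ 2 →
        𝔼 ω, Real.exp (ν * (X q.1 ω - X q.2 ω)) ≤ E := by
      intro q hq ν hν
      refine (hsub _ _ _).trans (Real.exp_le_exp.2 ?_)
      have hq2 := (Finset.mem_filter.1 hq).2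
      rw [hν]
      calc (μ * 2 ^ (k + 1)) ^ 2 * s * ((symmDiff q.1 q.2).card : ℝ)
          ≤ (μ * 2 ^ (k + 1)) ^ 2 * s * (2 * (1 / 4) ^ k * n) := by gcongr
        _ = 2 * μ ^ 2 * s * n * ((2 ^ (k + 1)) ^ 2 * (1 / 4) ^ k) := by ring
        _ = 8 * μ ^ 2 * s * n := by rw [hpow]; ring
    have h2 : 𝔼 ω, W k ω ≤ ∑ q ∈ links k, (E + E) := by
      simp only [W]
      rw [Finset.expect_sum_comm]
      refine Finset.sum_le_sum fun q hq => ?_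
      rw [Finset.expect_add_distrib]
      exact add_le_add (h1 q hq _ rfl) (h1 q hq _ (by ring))
    rw [Finset.sum_const, nsmul_eq_mul] at h2
    calc Real.exp (-L k) * 𝔼 ω, W k ω ≤ Real.exp (-L k) * ((links k).card * (E + E)) :=
          mul_le_mul_of_nonneg_left h2 (Real.exp_pos _).le
      _ = (2 * (links k).card) * Real.exp (-L k) * E := by ring
      _ ≤ Real.exp (L k) * Real.exp (-L k) * E := by
          gcongr; exact hlinkcard k
      _ = E := by rw [← Real.exp_add]; simp
  calc 𝔼 ω, Real.exp (μ * Y ω) ≤ 𝔼 ω, Real.exp B *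
      ((1 / 2) ^ K + ∑ k ∈ Finset.range K, (1 / 2) ^ (k + 1) * (Real.exp (-L k) * W k ω)) :=
        Finset.expect_le_expect fun ω _ => hpoint ω
    _ = Real.exp B * ((1 / 2) ^ K + ∑ k ∈ Finset.range K,
          (1 / 2) ^ (k + 1) * (Real.exp (-L k) * 𝔼 ω, W k ω)) := by
        rw [← Finset.mul_expect, Finset.expect_add_distrib, Fintype.expect_const,
          Finset.expect_sum_comm]
        simp only [Finset.mul_expect]
    _ ≤ Real.exp B * ((1 / 2) ^ K * E + ∑ k ∈ Finset.range K, (1 / 2) ^ (k + 1) * E) := by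
        refine mul_le_mul_of_nonneg_left ?_ (Real.exp_pos _).le
        refine add_le_add (le_mul_of_one_le_right (by positivity) hE1)
          (Finset.sum_le_sum fun k _ => ?_)
        exact mul_le_mul_of_nonneg_left (hW k) (by positivity)
    _ = Real.exp B * E := by
        rw [← Finset.sum_mul, ← add_mul, half_pow_add_sum, one_mul]
    _ = Real.exp (B + 8 * μ ^ 2 * s * n) := (Real.exp_add _ _).symm

/-! ### Rademacher sums and symmetrization -/

/-- The Rademacher sign attached to a Boolean. -/
noncomputable def boolSign (e : Bool) : ℝ := if e then 1 else -1

/-- Hoeffding's bound for the moment generating function of a Rademacher sum. -/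
lemma expect_exp_rademacher_le {b : ℕ} (c : Fin b → ℝ) :
    𝔼 e : Fin b → Bool, Real.exp (∑ j, boolSign (e j) * c j) ≤
      Real.exp (∑ j, c j ^ 2 / 2) := by
  rw [Fintype.expect_eq_sum_div_card, Fintype.card_fun, Fintype.card_bool, Fintype.card_fin]
  have h1 : ∑ e : Fin b → Bool, Real.exp (∑ j, boolSign (e j) * c j) =
      ∏ j, ∑ e : Bool, Real.exp (boolSign e * c j) := by
    rw [Finset.prod_univ_sum, Fintype.piFinset_univ]
    exact Finset.sum_congr rfl fun e _ => Real.exp_sum _ _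
  rw [h1, div_le_iff₀ (by positivity), Real.exp_sum]
  calc ∏ j, ∑ e : Bool, Real.exp (boolSign e * c j) = ∏ j, (Real.cosh (c j) * 2) := by
        refine Finset.prod_congr rfl fun j _ => ?_
        rw [Fintype.sum_bool, Real.cosh_eq]
        simp [boolSign]
    _ ≤ ∏ j, (Real.exp (c j ^ 2 / 2) * 2) := by
        refine Finset.prod_le_prod (fun j _ => by positivity) fun j _ => ?_
        gcongr
        exact Real.cosh_le_exp_half_sq _
    _ = (∏ j, Real.exp (c j ^ 2 / 2)) * ((2 ^ b : ℕ) : ℝ) := by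
        rw [Finset.prod_mul_distrib]; simp

lemma sum_eval_eq_zero {V ι α : Type*} [AddCommGroup V] [Fintype ι] [DecidableEq ι] [Fintype α] (a : α → V)
    (ha : ∑ i, a i = 0) (j : ι) : ∑ σ : ι → α, a (σ j) = 0 := by
  rw [Fintype.sum_equiv (Equiv.funSplitAt j α) _ (fun q => a q.1) (fun σ => by simp),
    Fintype.sum_prod_type_right]
  simp [ha]

section Convex

variable {V : Type*} [AddCommGroup V] [Module ℝ V]

lemma le_expect_of_convexOn {ι : Type*} {Ψ : V → ℝ} (hΨ : ConvexOn ℝ Set.univ Ψ)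
    {s : Finset ι} (hs : s.Nonempty) {f : ι → V} {v : V} (hv : (s.card : ℝ) • v = ∑ i ∈ s, f i) :
    Ψ v ≤ 𝔼 i ∈ s, Ψ (f i) := by
  have hc : (0 : ℝ) < s.card := by exact_mod_cast hs.card_pos
  have h := hΨ.map_sum_le (t := s) (w := fun _ => (s.card : ℝ)⁻¹) (p := f)
    (fun _ _ => by positivity) (by rw [Finset.sum_const, nsmul_eq_mul, mul_inv_cancel₀ hc.ne'])
    (fun _ _ => Set.mem_univ _)
  rw [← Finset.smul_sum, ← hv, inv_smul_smul₀ hc.ne'] at h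
  rw [Finset.expect_eq_sum_div_card, div_eq_inv_mul, Finset.mul_sum]
  simpa using h

/-- Symmetrization by an independent copy and Rademacher signs. -/
lemma expect_le_expect_symmetrization {α : Type*} [Fintype α] [Nonempty α] {b : ℕ} {Ψ : V → ℝ}
    (hΨ : ConvexOn ℝ Set.univ Ψ) (a : α → V) (ha : ∑ i, a i = 0) :
    𝔼 σ : Fin b → α, Ψ (∑ j, a (σ j)) ≤
      𝔼 ω : Fin b → α × α, 𝔼 e : Fin b → Bool,
        Ψ (∑ j, boolSign (e j) • (a (ω j).1 - a (ω j).2)) := by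
  let G : (Fin b → α × α) → ℝ := fun ω => Ψ (∑ j, (a (ω j).1 - a (ω j).2))
  have h1 : 𝔼 σ : Fin b → α, Ψ (∑ j, a (σ j)) ≤ 𝔼 ω, G ω := by
    rw [Fintype.expect_equiv (Equiv.arrowProdEquivProdArrow (Fin b) (fun _ => α) (fun _ => α)) G
      (fun q => Ψ (∑ j, (a (q.1 j) - a (q.2 j)))) (fun ω => rfl), ← Finset.univ_product_univ,
      Finset.expect_product]
    -- Averaging the independent copy gives `0`, because `a` is centered; this is Jensen in the
    -- second sample.
    refine Finset.expect_le_expect fun σ _ => le_expect_of_convexOn hΨ Finset.univ_nonempty ?_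
    simp only [Finset.sum_sub_distrib, Finset.sum_const]
    rw [Finset.sum_comm (f := fun (σ' : Fin b → α) j => a (σ' j))]
    rw [Nat.cast_smul_eq_nsmul]
    simp [sum_eval_eq_zero a ha]
  -- Exchanging the two copies at the coordinates with sign `-1` preserves the uniform law and
  -- realizes the signs.
  let sw : (Fin b → Bool) → (Fin b → α × α) → (Fin b → α × α) :=
    fun e ω j => if e j then ω j else (ω j).swap
  have hsw : ∀ e, Function.Involutive (sw e) := by
    intro e ω
    funext j
    by_cases h : e j <;> simp [sw, h]
  refine h1.trans (le_of_eq ?_)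
  rw [Finset.expect_comm]
  have h2 : ∀ e : Fin b → Bool,
      𝔼 ω : Fin b → α × α, Ψ (∑ j, boolSign (e j) • (a (ω j).1 - a (ω j).2)) = 𝔼 ω, G ω := by
    intro e
    refine Fintype.expect_equiv (hsw e).toPerm _ _ fun ω => ?_
    simp only [G, Function.Involutive.coe_toPerm, sw]
    congr 1
    refine Finset.sum_congr rfl fun j _ => ?_
    by_cases h : e j <;> simp [boolSign, h]
  simp only [h2]
  rw [Fintype.expect_const]

end Convex

/-! ### Sampling without replacement versus i.i.d. sampling -/

/-- Equal coincidence patterns give a bijection between the ranges, which extends to a permutation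
since `α` is finite. -/
lemma exists_perm_comp_eq {β α : Type*} [Fintype α] [DecidableEq α] {f g : β → α}
    (h : ∀ i j, f i = f j ↔ g i = g j) : ∃ π : Equiv.Perm α, ∀ i, π (f i) = g i := by
  classical
  let e : {x // x ∈ Set.range f} ≃ {x // x ∈ Set.range g} :=
    { toFun := fun x => ⟨g x.2.choose, ⟨_, rfl⟩⟩
      invFun := fun y => ⟨f y.2.choose, ⟨_, rfl⟩⟩
      left_inv := fun x => by
        refine Subtype.ext ?_
        have h1 := x.2.choose_spec
        have h2 : g x.2.choose ∈ Set.range g := ⟨_, rfl⟩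
        exact ((h _ _).2 h2.choose_spec).trans h1
      right_inv := fun y => by
        refine Subtype.ext ?_
        have h1 := y.2.choose_spec
        have h2 : f y.2.choose ∈ Set.range f := ⟨_, rfl⟩
        exact ((h _ _).1 h2.choose_spec).trans h1 }
  refine ⟨e.extendSubtype, fun i => ?_⟩
  have hi : f i ∈ Set.range f := ⟨i, rfl⟩
  rw [Equiv.extendSubtype_apply_of_mem e (f i) hi]
  exact (h _ _).1 hi.choose_spec

section Comparison

variable {V : Type*} [AddCommGroup V] [Module ℝ V] {α : Type*} [Fintype α] [DecidableEq α] {b : ℕ}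

lemma expect_perm_congr (F : (Fin b → α) → ℝ) {f g : Fin b → α}
    (h : ∀ i j, f i = f j ↔ g i = g j) :
    𝔼 ρ : Equiv.Perm α, F (fun j => ρ (f j)) = 𝔼 ρ : Equiv.Perm α, F (fun j => ρ (g j)) := by
  obtain ⟨π, hπ⟩ := exists_perm_comp_eq h
  refine (Fintype.expect_equiv (Equiv.mulRight π) _ _ fun ρ => ?_).symm
  simp [hπ]

/-- Let `p` choose a representative in each fibre of `f`. For every cyclic shift `c`, the tuple `τ
(p j + c)` has the coincidences of `f`, hence the same expectation under random relabelling.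
Averaged over `c`, each summand runs through all of `τ`, so the mean of the shifted sums is the sum
over `τ`, and Jensen applies. -/
lemma expect_perm_injective_le [NeZero b] {Ψ : V → ℝ} (hΨ : ConvexOn ℝ Set.univ Ψ) (a : α → V)
    {τ f : Fin b → α} (hτ : Function.Injective τ) :
    𝔼 ρ : Equiv.Perm α, Ψ (∑ j, a (ρ (τ j))) ≤ 𝔼 ρ : Equiv.Perm α, Ψ (∑ j, a (ρ (f j))) := by
  let p : Fin b → Fin b := fun j => Function.invFun f (f j)
  have hp : ∀ j, f (p j) = f j := fun j => Function.invFun_eq ⟨j, rfl⟩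
  have hker : ∀ c i j, f i = f j ↔ τ (p i + c) = τ (p j + c) := by
    intro c i j
    rw [hτ.eq_iff, add_left_inj]
    refine ⟨fun h => by simp only [p, h], fun h => ?_⟩
    rw [← hp i, h, hp]
  have h1 : 𝔼 ρ : Equiv.Perm α, Ψ (∑ j, a (ρ (f j))) =
      𝔼 c : Fin b, 𝔼 ρ : Equiv.Perm α, Ψ (∑ j, a (ρ (τ (p j + c)))) := by
    have : ∀ c : Fin b, 𝔼 ρ : Equiv.Perm α, Ψ (∑ j, a (ρ (τ (p j + c)))) =
        𝔼 ρ : Equiv.Perm α, Ψ (∑ j, a (ρ (f j))) := fun c =>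
      (expect_perm_congr (fun g => Ψ (∑ j, a (g j))) (hker c)).symm
    simp only [this]
    rw [Fintype.expect_const]
  rw [h1, Finset.expect_comm]
  refine Finset.expect_le_expect fun ρ _ => le_expect_of_convexOn hΨ Finset.univ_nonempty ?_
  rw [Finset.sum_comm]
  have h2 : ∀ j : Fin b, ∑ c, a (ρ (τ (p j + c))) = ∑ i, a (ρ (τ i)) := fun j =>
    Fintype.sum_equiv (Equiv.addLeft (p j)) _ _ fun c => rfl
  simp only [h2, Finset.sum_const, Nat.cast_smul_eq_nsmul]

/-- Hoeffding's comparison of sampling without replacement with i.i.d. sampling. -/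
lemma expect_injective_le_expect [NeZero b] {Ψ : V → ℝ} (hΨ : ConvexOn ℝ Set.univ Ψ) (a : α → V)
    {I : Finset (Fin b → α)} (hI : ∀ τ, τ ∈ I ↔ Function.Injective τ) (hne : I.Nonempty) :
    𝔼 τ ∈ I, Ψ (∑ j, a (τ j)) ≤ 𝔼 f : Fin b → α, Ψ (∑ j, a (f j)) := by
  have : Nonempty α := let ⟨τ, _⟩ := hne; ⟨τ 0⟩
  -- Both sampling laws are invariant under relabelling `α`, so `Ψ` may be replaced by its average
  -- over permutations, which can be compared tuple by tuple.
  let A : (Fin b → α) → ℝ := fun f => 𝔼 ρ : Equiv.Perm α, Ψ (∑ j, a (ρ (f j)))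
  have h1 : 𝔼 τ ∈ I, Ψ (∑ j, a (τ j)) = 𝔼 τ ∈ I, A τ := by
    have : ∀ ρ : Equiv.Perm α, 𝔼 τ ∈ I, Ψ (∑ j, a (ρ (τ j))) = 𝔼 τ ∈ I, Ψ (∑ j, a (τ j)) :=
      fun ρ => Finset.expect_equiv (Equiv.arrowCongr (Equiv.refl _) ρ)
        (fun τ => by
          simp only [hI]
          exact (ρ.injective.of_comp_iff τ).symm) (fun τ _ => rfl)
    simp only [A]
    rw [Finset.expect_comm]
    simp only [this]
    rw [Fintype.expect_const]
  have h2 : 𝔼 f : Fin b → α, Ψ (∑ j, a (f j)) = 𝔼 f, A f := by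
    have : ∀ ρ : Equiv.Perm α, 𝔼 f : Fin b → α, Ψ (∑ j, a (ρ (f j))) =
        𝔼 f : Fin b → α, Ψ (∑ j, a (f j)) :=
      fun ρ => Fintype.expect_equiv (Equiv.arrowCongr (Equiv.refl _) ρ) _ _ (fun τ => rfl)
    simp only [A]
    rw [Finset.expect_comm]
    simp only [this]
    rw [Fintype.expect_const]
  rw [h1, h2]
  refine Finset.expect_le hne fun τ hτ => ?_
  exact Finset.le_expect Finset.univ_nonempty fun f _ =>
    expect_perm_injective_le hΨ a ((hI τ).1 hτ)

end Comparison

/-! ### Uniform deviations over half-spaces -/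

lemma convexOn_exp_mul_norm {V : Type*} [NormedAddCommGroup V] [NormedSpace ℝ V] {μ : ℝ}
    (hμ : 0 ≤ μ) : ConvexOn ℝ Set.univ fun v : V => Real.exp (μ * ‖v‖) := by
  have h1 : ConvexOn ℝ Set.univ fun v : V => μ * ‖v‖ := by
    simpa using convexOn_univ_norm.smul hμ
  exact (convexOn_exp.subset (Set.subset_univ _)
    ((isPreconnected_univ.image _ (by fun_prop)).ordConnected.convex)).comp h1
    (Real.exp_monotone.monotoneOn _)

/-- The centered vector of weighted indicators of half-space traces at the data point `i`. -/
noncomputable def centeredTrace {d N : ℕ} (x : Fin N → EuclideanSpace ℝ (Fin d)) (v : Fin N → ℝ) (i : Fin N) :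
    (halfTraces x → ℝ) :=
  fun H => (if i ∈ H.1 then v i else 0) - (1 / (N : ℝ)) * ∑ k, if k ∈ H.1 then v k else 0

lemma sum_centeredTrace {d N : ℕ} (hN : 0 < N) (x : Fin N → EuclideanSpace ℝ (Fin d))
    (v : Fin N → ℝ) : ∑ i, centeredTrace x v i = 0 := by
  funext H
  have : (N : ℝ) ≠ 0 := by positivity
  simp only [Finset.sum_apply, centeredTrace, Finset.sum_sub_distrib, Finset.sum_const,
    Finset.card_univ, Fintype.card_fin, nsmul_eq_mul, Pi.zero_apply]
  field_simp
  ring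

lemma halfTraces_nonempty {d : ℕ} {ι : Type*} [Fintype ι] (x : ι → EuclideanSpace ℝ (Fin d)) :
    (halfTraces x).Nonempty :=
  ⟨Finset.univ, mem_halfTraces.2 ⟨0, 0, by simp⟩⟩

/-- Exponential moments of the symmetrized empirical process over half-spaces. -/
lemma exists_expect_exp_rademacher_trace_le (d : ℕ) : ∃ c : ℝ, 0 ≤ c ∧
    ∀ {N b : ℕ}, 0 < b → ∀ (x : Fin N → EuclideanSpace ℝ (Fin d)) (v : Fin N → ℝ) {B : ℝ},
      (∀ i, |v i| ≤ B) → ∀ (ω : Fin b → Fin N × Fin N) {μ : ℝ}, 0 ≤ μ →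
      𝔼 e : Fin b → Bool, Real.exp (μ * ‖∑ j, boolSign (e j) •
        (centeredTrace x v (ω j).1 - centeredTrace x v (ω j).2)‖) ≤
          Real.exp (c + 16 * μ ^ 2 * B ^ 2 * b) := by
  obtain ⟨a, ha, hnet⟩ := exists_net d
  refine ⟨5 * a + Real.log 2, add_nonneg (by positivity) (Real.log_nonneg (by norm_num)), ?_⟩
  intro N b hb x v B hv ω μ hμ
  have : Nonempty (Fin b) := ⟨⟨0, hb⟩⟩
  -- Conditionally on the double sample only the traces on `2b` points matter, so the bound is
  -- independent of `N`. The population means in `centeredTrace` cancel in the differences.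
  let x' : Fin b ⊕ Fin b → EuclideanSpace ℝ (Fin d) :=
    Sum.elim (fun j => x (ω j).1) (fun j => x (ω j).2)
  let D : Finset (Fin b ⊕ Fin b) → Fin b → ℝ := fun H j =>
    (if Sum.inl j ∈ H then v (ω j).1 else 0) - (if Sum.inr j ∈ H then v (ω j).2 else 0)
  let X : Finset (Fin b ⊕ Fin b) → (Fin b → Bool) → ℝ := fun H e => ∑ j, boolSign (e j) * D H j
  have hsub : ∀ H H' ν, 𝔼 e, Real.exp (ν * (X H e - X H' e)) ≤
      Real.exp (ν ^ 2 * B ^ 2 * (symmDiff H H').card) := by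
    intro H H' ν
    have h1 : ∀ e, ν * (X H e - X H' e) = ∑ j, boolSign (e j) * (ν * (D H j - D H' j)) := by
      intro e
      simp only [X]
      rw [← Finset.sum_sub_distrib, Finset.mul_sum]
      exact Finset.sum_congr rfl fun j _ => by ring
    simp only [h1]
    refine (expect_exp_rademacher_le _).trans (Real.exp_le_exp.2 ?_)
    have h2 : ∀ j, (ν * (D H j - D H' j)) ^ 2 / 2 ≤ ν ^ 2 * B ^ 2 *
        ((if Sum.inl j ∈ symmDiff H H' then 1 else 0) +
          (if Sum.inr j ∈ symmDiff H H' then 1 else 0)) := by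
      intro j
      have key : ∀ (k : Fin b ⊕ Fin b) (i : Fin N),
          ((if k ∈ H then v i else 0) - (if k ∈ H' then v i else 0)) ^ 2 ≤
            B ^ 2 * (if k ∈ symmDiff H H' then 1 else 0) := by
        intro k i
        have hi : v i ^ 2 ≤ B ^ 2 := sq_le_sq' (abs_le.1 (hv i)).1 (abs_le.1 (hv i)).2
        by_cases h1 : k ∈ H <;> by_cases h2 : k ∈ H' <;>
          simp [h1, h2, Finset.mem_symmDiff, hi]
      have k1 := key (Sum.inl j) (ω j).1
      have k2 := key (Sum.inr j) (ω j).2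
      simp only [D]
      set p := (if Sum.inl j ∈ H then v (ω j).1 else 0)
      set p' := (if Sum.inl j ∈ H' then v (ω j).1 else 0)
      set q := (if Sum.inr j ∈ H then v (ω j).2 else 0)
      set q' := (if Sum.inr j ∈ H' then v (ω j).2 else 0)
      have h3 : ((p - q) - (p' - q')) ^ 2 / 2 ≤ (p - p') ^ 2 + (q - q') ^ 2 := by
        nlinarith [sq_nonneg ((p - p') + (q - q'))]
      calc (ν * ((p - q) - (p' - q'))) ^ 2 / 2 = ν ^ 2 * (((p - q) - (p' - q')) ^ 2 / 2) := by ring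
        _ ≤ ν ^ 2 * (B ^ 2 * (if Sum.inl j ∈ symmDiff H H' then 1 else 0) +
              B ^ 2 * (if Sum.inr j ∈ symmDiff H H' then 1 else 0)) := by
            refine mul_le_mul_of_nonneg_left ?_ (sq_nonneg ν)
            linarith
        _ = _ := by ring
    refine (Finset.sum_le_sum fun j _ => h2 j).trans (le_of_eq ?_)
    rw [← Finset.mul_sum, Finset.sum_add_distrib]
    congr 1
    rw [← Fintype.sum_sum_type (fun k => if k ∈ symmDiff H H' then (1 : ℝ) else 0)]
    simp
  have hY : ∀ e : Fin b → Bool, ∃ H ∈ halfTraces x', ‖∑ j, boolSign (e j) •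
        (centeredTrace x v (ω j).1 - centeredTrace x v (ω j).2)‖ ≤ |X H e| := by
    intro e
    have : Nonempty (halfTraces x) := (halfTraces_nonempty x).to_subtype
    set z := ∑ j, boolSign (e j) •
        (centeredTrace x v (ω j).1 - centeredTrace x v (ω j).2) with hz
    obtain ⟨H, hmax⟩ := Finite.exists_max fun H => ‖z H‖
    have hH : ‖z‖ ≤ ‖z H‖ := (pi_norm_le_iff_of_nonneg (norm_nonneg _)).2 hmax
    obtain ⟨w, t, hwt⟩ := mem_halfTraces.1 H.2
    refine ⟨Finset.univ.filter fun k => Sum.elim (fun j => (ω j).1) (fun j => (ω j).2) k ∈ H.1,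
      mem_halfTraces.2 ⟨w, t, ?_⟩, ?_⟩
    · rintro (j | j) <;> simp [x', hwt]
    · refine hH.trans (le_of_eq ?_)
      rw [Real.norm_eq_abs, hz]
      refine congrArg _ ?_
      simp only [X, D, Finset.sum_apply, Pi.smul_apply, Pi.sub_apply, centeredTrace, smul_eq_mul]
      refine Finset.sum_congr rfl fun j _ => ?_
      simp
  have := expect_exp_le_of_chaining (halfTraces x') X (sq_nonneg B) ha (fun e => by simp [X, D])
    hsub (hnet x') _ hY hμ
  refine this.trans (le_of_eq ?_)
  rw [Fintype.card_sum, Fintype.card_fin]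
  push_cast
  ring_nf

/-- Exponential moments of the empirical process over half-spaces, for sampling with or without
replacement. -/
lemma exists_expect_exp_trace_le (d : ℕ) : ∃ c : ℝ, 0 ≤ c ∧
    ∀ {N b : ℕ}, 0 < N → 0 < b → ∀ (x : Fin N → EuclideanSpace ℝ (Fin d)) (v : Fin N → ℝ) {B : ℝ},
      (∀ i, |v i| ≤ B) → ∀ I : Finset (Fin b → Fin N), I.Nonempty →
      (I = Finset.univ ∨ ∀ τ, τ ∈ I ↔ Function.Injective τ) → ∀ {μ : ℝ}, 0 ≤ μ →
      𝔼 σ ∈ I, Real.exp (μ * ‖∑ j, centeredTrace x v (σ j)‖) ≤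
        Real.exp (c + 16 * μ ^ 2 * B ^ 2 * b) := by
  obtain ⟨c, hc, h⟩ := exists_expect_exp_rademacher_trace_le d
  refine ⟨c, hc, ?_⟩
  intro N b hN hb x v B hv I hne hI μ hμ
  have : NeZero b := ⟨hb.ne'⟩
  have : Nonempty (Fin N) := ⟨⟨0, hN⟩⟩
  have hiid : 𝔼 σ : Fin b → Fin N, Real.exp (μ * ‖∑ j, centeredTrace x v (σ j)‖) ≤
      Real.exp (c + 16 * μ ^ 2 * B ^ 2 * b) :=
    (expect_le_expect_symmetrization (convexOn_exp_mul_norm hμ) _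
      (sum_centeredTrace hN x v)).trans
      (Finset.expect_le Finset.univ_nonempty fun ω _ => h hb x v hv ω hμ)
  rcases hI with rfl | hI
  · exact hiid
  · exact (expect_injective_le_expect (convexOn_exp_mul_norm hμ) _ hI hne).trans hiid

/-- The difference of the weighted sample and population masses of a half-space. -/
noncomputable def massGap {d N b : ℕ} (x : Fin N → EuclideanSpace ℝ (Fin d)) (v : Fin N → ℝ)
    (σ : Fin b → Fin N) (w : EuclideanSpace ℝ (Fin d)) (t : ℝ) : ℝ :=
  (1 / (N : ℝ)) * (∑ i, if inner ℝ w (x i) ≤ t then v i else 0) -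
    (1 / (b : ℝ)) * ∑ j, if inner ℝ w (x (σ j)) ≤ t then v (σ j) else 0

lemma abs_massGap_le {d N b : ℕ} (hb : 0 < b) (x : Fin N → EuclideanSpace ℝ (Fin d))
    (v : Fin N → ℝ) (σ : Fin b → Fin N) (w : EuclideanSpace ℝ (Fin d)) (t : ℝ) :
    |massGap x v σ w t| ≤ (1 / (b : ℝ)) * ‖∑ j, centeredTrace x v (σ j)‖ := by
  classical
  have hb' : (0 : ℝ) < b := by exact_mod_cast hb
  let H : halfTraces x := ⟨Finset.univ.filter fun i => inner ℝ w (x i) ≤ t,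
    mem_halfTraces.2 ⟨w, t, by simp⟩⟩
  have h1 : massGap x v σ w t = -((1 / (b : ℝ)) * (∑ j, centeredTrace x v (σ j)) H) := by
    simp only [massGap, Finset.sum_apply, centeredTrace, H, Finset.mem_filter, Finset.mem_univ,
      true_and, Finset.sum_sub_distrib, Finset.sum_const, Finset.card_univ, Fintype.card_fin,
      nsmul_eq_mul]
    field_simp
    ring
  rw [h1, abs_neg, abs_mul, abs_of_pos (by positivity : 0 < 1 / (b : ℝ)), ← Real.norm_eq_abs]
  exact mul_le_mul_of_nonneg_left (norm_le_pi_norm _ H) (by positivity)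

open scoped Classical in
/-- Uniform deviation inequality for half-spaces with the optimal rate. -/
lemma exists_card_massGap_le (d : ℕ) {B δ₀ : ℝ} (hB : 0 < B) (hδ₀ : δ₀ < 1) : ∃ K : ℝ, 0 ≤ K ∧
    ∀ {N b : ℕ}, 0 < N → 0 < b → ∀ (x : Fin N → EuclideanSpace ℝ (Fin d)) (v : Fin N → ℝ),
      (∀ i, |v i| ≤ B) → ∀ I : Finset (Fin b → Fin N), I.Nonempty →
      (I = Finset.univ ∨ ∀ τ, τ ∈ I ↔ Function.Injective τ) → ∀ {δ : ℝ}, 0 < δ → δ ≤ δ₀ →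
      ((I.filter fun σ => ¬ ∀ w t, |massGap x v σ w t| ≤
        K * √(1 / b * Real.log (1 / δ))).card : ℝ) ≤ δ / 2 * I.card := by
  obtain ⟨c, hc, hexp⟩ := exists_expect_exp_trace_le d
  rcases le_or_gt δ₀ 0 with hneg | hδ₀pos
  · exact ⟨0, le_rfl, fun _ _ _ _ _ _ _ _ δ h1 h2 => by linarith⟩
  set ℓ := Real.log (1 / δ₀) with hℓ
  have hℓpos : 0 < ℓ := Real.log_pos (by rw [lt_div_iff₀ hδ₀pos]; linarith)
  have hlog2 : 0 ≤ Real.log 2 := Real.log_nonneg (by norm_num)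
  -- Chosen so that `T q ≥ q + c + log 2` whenever `q ≥ ℓ`: the additive constants are paid for by
  -- `log (1/δ) ≥ ℓ > 0`.
  set T := 1 + (c + Real.log 2) / ℓ with hT
  have hT0 : 0 ≤ T := by positivity
  refine ⟨√(64 * B ^ 2 * T), Real.sqrt_nonneg _, ?_⟩
  intro N b hN hb x v hv I hne hI δ hδ hδδ₀
  have hb' : (0 : ℝ) < b := by exact_mod_cast hb
  set q := Real.log (1 / δ) with hq
  have hqℓ : ℓ ≤ q := Real.log_le_log (by positivity)
    (one_div_le_one_div_of_le hδ hδδ₀)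
  have hq0 : 0 ≤ q := hℓpos.le.trans hqℓ
  set ε := √(64 * B ^ 2 * T) * √(1 / b * q) with hε
  have hε0 : 0 ≤ ε := by positivity
  have hε2 : ε ^ 2 = 64 * B ^ 2 * T * (1 / b * q) := by
    rw [hε, mul_pow, Real.sq_sqrt (by positivity), Real.sq_sqrt (by positivity)]
  -- The minimizer of the Chernoff exponent `16 μ² B² b - μ b ε`, with minimum `-b ε² / (64 B²)`.
  set μ := ε / (32 * B ^ 2) with hμ
  have hμ0 : 0 ≤ μ := by positivity
  have h1 := hexp hN hb x v hv I hne hI hμ0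
  rw [Finset.expect_eq_sum_div_card, div_le_iff₀ (by exact_mod_cast hne.card_pos)] at h1
  set J := I.filter fun σ => ¬ ∀ w t, |massGap x v σ w t| ≤ ε
  have h2 : (J.card : ℝ) * Real.exp (μ * (b * ε)) ≤
      ∑ σ ∈ I, Real.exp (μ * ‖∑ j, centeredTrace x v (σ j)‖) := by
    rw [← nsmul_eq_mul, ← Finset.sum_const]
    refine (Finset.sum_le_sum fun σ hσ => ?_).trans (Finset.sum_le_sum_of_subset_of_nonneg
      (Finset.filter_subset _ _) fun _ _ _ => (Real.exp_pos _).le)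
    obtain ⟨_, hσ2⟩ := Finset.mem_filter.1 hσ
    push Not at hσ2
    obtain ⟨w, t, hwt⟩ := hσ2
    have h3 := hwt.trans_le (abs_massGap_le hb x v σ w t)
    refine Real.exp_le_exp.2 (mul_le_mul_of_nonneg_left ?_ hμ0)
    rw [one_div, ← div_eq_inv_mul, lt_div_iff₀ hb'] at h3
    linarith
  have h4 : c + 16 * μ ^ 2 * B ^ 2 * b - μ * (b * ε) ≤ Real.log (δ / 2) := by
    have e1 : c + 16 * μ ^ 2 * B ^ 2 * b - μ * (b * ε) = c - b * ε ^ 2 / (64 * B ^ 2) := by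
      rw [hμ]; field_simp; ring
    have e2 : b * ε ^ 2 / (64 * B ^ 2) = T * q := by rw [hε2]; field_simp
    have e3 : Real.log (δ / 2) = -q - Real.log 2 := by
      rw [Real.log_div hδ.ne' (by norm_num), hq, one_div, Real.log_inv, neg_neg]
    have e4 : c + Real.log 2 ≤ (c + Real.log 2) / ℓ * q := by
      rw [div_mul_eq_mul_div, le_div_iff₀ hℓpos]
      exact mul_le_mul_of_nonneg_left hqℓ (by positivity)
    rw [e1, e2, e3, hT]
    linarith
  have h5 : (J.card : ℝ) * Real.exp (μ * (b * ε)) ≤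
      (δ / 2 * I.card) * Real.exp (μ * (b * ε)) := by
    calc (J.card : ℝ) * Real.exp (μ * (b * ε))
        ≤ Real.exp (c + 16 * μ ^ 2 * B ^ 2 * b) * I.card := h2.trans h1
      _ = Real.exp (c + 16 * μ ^ 2 * B ^ 2 * b - μ * (b * ε)) * I.card *
            Real.exp (μ * (b * ε)) := by
          rw [mul_right_comm (Real.exp _), ← Real.exp_add, sub_add_cancel]
      _ ≤ Real.exp (Real.log (δ / 2)) * I.card * Real.exp (μ * (b * ε)) := by
          gcongr
      _ = _ := by rw [Real.exp_log (by positivity)]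
  exact le_of_mul_le_mul_right h5 (Real.exp_pos _)

/-! ### Bounded variation and empirical distribution functions -/

/-- Abel summation: a signed discrete measure with small distribution function has small
integrals against functions of bounded variation, the variation being controlled by `h`. -/
lemma abs_sum_mul_sub_le (P : Finset ℝ) (m g h : ℝ → ℝ) {lo ε : ℝ} (hi : ℝ) (hlohi : lo ≤ hi)
    (hP : ∀ p ∈ P, lo ≤ p ∧ p ≤ hi)
    (hvar : ∀ p q, lo ≤ p → p ≤ q → q ≤ hi → |g p - g q| ≤ h q - h p)
    (hε : ∀ t, |∑ p ∈ P with p ≤ t, m p| ≤ ε) :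
    |∑ p ∈ P, g p * m p - g hi * ∑ p ∈ P, m p| ≤ (h hi - h lo) * ε := by
  induction P using Finset.induction_on_max generalizing hi with
  | empty =>
    have h1 : 0 ≤ h hi - h lo := (abs_nonneg _).trans (hvar lo hi le_rfl hlohi le_rfl)
    have h2 : 0 ≤ ε := (abs_nonneg _).trans (hε 0)
    simpa using mul_nonneg h1 h2
  | insert a P' hmax ih =>
    have ha := hP a (Finset.mem_insert_self _ _)
    have hnot : a ∉ P' := fun h => lt_irrefl _ (hmax a h)
    have hε0 : 0 ≤ ε := (abs_nonneg _).trans (hε 0)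
    have htot : |∑ p ∈ insert a P', m p| ≤ ε := by
      have := hε a
      rwa [Finset.filter_true_of_mem] at this
      intro p hp
      rcases Finset.mem_insert.1 hp with rfl | hp
      · exact le_rfl
      · exact (hmax p hp).le
    have hlow : ∀ t, t < a → (insert a P').filter (· ≤ t) = P'.filter (· ≤ t) := fun t ht => by
      rw [Finset.filter_insert, if_neg (not_le.2 ht)]
    have hε' : ∀ t, |∑ p ∈ P' with p ≤ t, m p| ≤ ε := by
      intro t
      rcases lt_or_ge t a with ht | ht
      · rw [← hlow t ht]; exact hε t
      · rcases P'.eq_empty_or_nonempty with rfl | hne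
        · simpa using hε0
        · have h1 : P'.filter (· ≤ t) = P'.filter (· ≤ P'.max' hne) := by
            refine Finset.filter_congr fun p hp => ?_
            exact ⟨fun _ => P'.le_max' p hp, fun _ => (hmax p hp).le.trans ht⟩
          rw [h1, ← hlow _ (hmax _ (P'.max'_mem hne))]
          exact hε _
    -- The reference point moves from `hi` down to `a`; this costs `(g a - g hi)` times the total
    -- mass, and the variations telescope.
    have h1 := ih a ha.1 (fun p hp => ⟨(hP p (Finset.mem_insert_of_mem hp)).1, (hmax p hp).le⟩)
      (fun p q h1 h2 h3 => hvar p q h1 h2 (h3.trans ha.2)) hε'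
    have h2 : |(g a - g hi) * ∑ p ∈ insert a P', m p| ≤ (h hi - h a) * ε := by
      rw [abs_mul]
      exact mul_le_mul (hvar a hi ha.1 ha.2 le_rfl) htot (abs_nonneg _)
        ((abs_nonneg _).trans (hvar a hi ha.1 ha.2 le_rfl))
    have h3 : ∑ p ∈ insert a P', g p * m p - g hi * ∑ p ∈ insert a P', m p =
        (∑ p ∈ P', g p * m p - g a * ∑ p ∈ P', m p) +
          (g a - g hi) * ∑ p ∈ insert a P', m p := by
      rw [Finset.sum_insert hnot, Finset.sum_insert hnot]; ring
    rw [h3]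
    refine (abs_add_le _ _).trans ?_
    linarith

/-- Terms with equal `s k` are merged into one atom, which reduces ties to Abel summation over
distinct points. -/
lemma abs_sum_mul_comp_le {κ : Type*} (S : Finset κ) (s m : κ → ℝ) (g h : ℝ → ℝ) {lo hi ε : ℝ}
    (hlohi : lo ≤ hi) (hS : ∀ k ∈ S, lo ≤ s k ∧ s k ≤ hi)
    (hvar : ∀ p q, lo ≤ p → p ≤ q → q ≤ hi → |g p - g q| ≤ h q - h p)
    (hε : ∀ t, |∑ k ∈ S, if s k ≤ t then m k else 0| ≤ ε) :
    |∑ k ∈ S, m k * g (s k)| ≤ (|g hi| + (h hi - h lo)) * ε := by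
  classical
  let P := S.image s
  let M : ℝ → ℝ := fun p => ∑ k ∈ S with s k = p, m k
  have hmaps : ∀ k ∈ S, s k ∈ P := fun k hk => Finset.mem_image_of_mem s hk
  have hsum : ∑ k ∈ S, m k * g (s k) = ∑ p ∈ P, g p * M p := by
    rw [← Finset.sum_fiberwise_of_maps_to hmaps]
    refine Finset.sum_congr rfl fun p _ => ?_
    rw [Finset.mul_sum]
    refine Finset.sum_congr rfl fun k hk => ?_
    rw [(Finset.mem_filter.1 hk).2, mul_comm]
  have hcum : ∀ t, ∑ p ∈ P with p ≤ t, M p = ∑ k ∈ S, if s k ≤ t then m k else 0 := by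
    intro t
    rw [Finset.sum_filter, ← Finset.sum_fiberwise_of_maps_to hmaps]
    refine Finset.sum_congr rfl fun p _ => ?_
    by_cases hp : p ≤ t
    · rw [if_pos hp]
      refine Finset.sum_congr rfl fun k hk => ?_
      rw [(Finset.mem_filter.1 hk).2, if_pos hp]
    · rw [if_neg hp]
      refine (Finset.sum_eq_zero fun k hk => ?_).symm
      rw [(Finset.mem_filter.1 hk).2, if_neg hp]
  have hPb : ∀ p ∈ P, lo ≤ p ∧ p ≤ hi := by
    intro p hp
    obtain ⟨k, hk, rfl⟩ := Finset.mem_image.1 hp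
    exact hS k hk
  have h1 := abs_sum_mul_sub_le P M g h hi hlohi hPb hvar (fun t => by rw [hcum]; exact hε t)
  have h2 : |∑ p ∈ P, M p| ≤ ε := by
    have := hcum hi
    rw [Finset.filter_true_of_mem fun p hp => (hPb p hp).2] at this
    rw [this]; exact hε hi
  have h3 : |g hi * ∑ p ∈ P, M p| ≤ |g hi| * ε := by
    rw [abs_mul]; exact mul_le_mul_of_nonneg_left h2 (abs_nonneg _)
  rw [hsum]
  calc |∑ p ∈ P, g p * M p| =
      |g hi * ∑ p ∈ P, M p + (∑ p ∈ P, g p * M p - g hi * ∑ p ∈ P, M p)| := by ring_nf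
    _ ≤ |g hi| * ε + (h hi - h lo) * ε := (abs_add_le _ _).trans (add_le_add h3 h1)
    _ = _ := by ring

/-- Two weighted families form one signed family on the disjoint union, the second with negated
weights. -/
lemma abs_sum_sub_sum_le {ι ι' : Type*} (A : Finset ι) (A' : Finset ι') (s u : ι → ℝ)
    (s' u' : ι' → ℝ) (g h : ℝ → ℝ) {M ε : ℝ} (hM : 0 ≤ M)
    (hA : ∀ i ∈ A, |s i| ≤ M) (hA' : ∀ j ∈ A', |s' j| ≤ M)
    (hvar : ∀ p q, -M ≤ p → p ≤ q → q ≤ M → |g p - g q| ≤ h q - h p)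
    (hε : ∀ t, |(∑ i ∈ A, if s i ≤ t then u i else 0) -
      ∑ j ∈ A', if s' j ≤ t then u' j else 0| ≤ ε) :
    |(∑ i ∈ A, u i * g (s i)) - ∑ j ∈ A', u' j * g (s' j)| ≤
      (|g M| + (h M - h (-M))) * ε := by
  have h1 := abs_sum_mul_comp_le (A.disjSum A') (Sum.elim s s') (Sum.elim u (fun j => -u' j)) g h
    (lo := -M) (hi := M) (ε := ε) (by linarith)
    (by
      intro k hk
      rcases Finset.mem_disjSum.1 hk with ⟨i, hi, rfl⟩ | ⟨j, hj, rfl⟩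
      · exact abs_le.1 (hA i hi)
      · exact abs_le.1 (hA' j hj)) hvar
    (by
      intro t
      have : (∑ k ∈ A.disjSum A', if Sum.elim s s' k ≤ t then Sum.elim u (fun j => -u' j) k else 0) =
          (∑ i ∈ A, if s i ≤ t then u i else 0) - ∑ j ∈ A', if s' j ≤ t then u' j else 0 := by
        rw [Finset.sum_disjSum, sub_eq_add_neg, ← Finset.sum_neg_distrib]
        refine congrArg₂ _ rfl (Finset.sum_congr rfl fun j _ => ?_)
        by_cases hj : s' j ≤ t <;> simp [hj]
      rw [this]
      exact hε t)
  rw [Finset.sum_disjSum] at h1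
  simpa [← sub_eq_add_neg] using h1

/-- The empirical distribution function of a finite family. -/
noncomputable def cdf {ι : Type*} (A : Finset ι) (s : ι → ℝ) (t : ℝ) : ℝ :=
  (1 / (A.card : ℝ)) * ∑ i ∈ A, if s i ≤ t then 1 else 0

lemma cdf_mono {ι : Type*} (A : Finset ι) (s : ι → ℝ) : Monotone (cdf A s) := by
  intro p q hpq
  unfold cdf
  refine mul_le_mul_of_nonneg_left (Finset.sum_le_sum fun i _ => ?_) (by positivity)
  split_ifs with h1 h2
  · exact le_rfl
  · exact absurd (h1.trans hpq) h2
  · exact zero_le_one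
  · exact le_rfl

lemma cdf_nonneg {ι : Type*} (A : Finset ι) (s : ι → ℝ) (t : ℝ) : 0 ≤ cdf A s t := by
  unfold cdf; positivity

lemma mean_le {ι : Type*} (A : Finset ι) (f : ι → ℝ) {B : ℝ} (hB : 0 ≤ B)
    (h : ∀ i ∈ A, f i ≤ B) : (1 / (A.card : ℝ)) * ∑ i ∈ A, f i ≤ B := by
  rcases A.eq_empty_or_nonempty with rfl | hne
  · simpa using hB
  · have : (0 : ℝ) < A.card := by exact_mod_cast hne.card_pos
    rw [one_div, ← div_eq_inv_mul, div_le_iff₀ this, mul_comm]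
    simpa using Finset.sum_le_card_nsmul A f B h

lemma abs_mean_le {ι : Type*} (A : Finset ι) (f : ι → ℝ) {B : ℝ} (hB : 0 ≤ B)
    (h : ∀ i ∈ A, |f i| ≤ B) : |(1 / (A.card : ℝ)) * ∑ i ∈ A, f i| ≤ B := by
  rw [abs_mul, abs_of_nonneg (by positivity : 0 ≤ 1 / (A.card : ℝ))]
  exact (mul_le_mul_of_nonneg_left (Finset.abs_sum_le_sum_abs _ _) (by positivity)).trans
    (mean_le A _ hB h)

lemma cdf_le_one {ι : Type*} (A : Finset ι) (s : ι → ℝ) (t : ℝ) : cdf A s t ≤ 1 :=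
  mean_le A _ zero_le_one fun i _ => by split_ifs <;> norm_num

/-- Means of a function of bounded variation over two families with close distribution
functions. -/
lemma abs_mean_sub_mean_le {ι ι' : Type*} (A : Finset ι) (A' : Finset ι') (s : ι → ℝ)
    (s' : ι' → ℝ) (g h : ℝ → ℝ) {M η : ℝ} (hM : 0 ≤ M)
    (hA : ∀ i ∈ A, |s i| ≤ M) (hA' : ∀ j ∈ A', |s' j| ≤ M)
    (hvar : ∀ p q, -M ≤ p → p ≤ q → q ≤ M → |g p - g q| ≤ h q - h p)
    (hη : ∀ t, |cdf A s t - cdf A' s' t| ≤ η) :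
    |(1 / (A.card : ℝ)) * ∑ i ∈ A, g (s i) - (1 / (A'.card : ℝ)) * ∑ j ∈ A', g (s' j)| ≤
      (|g M| + (h M - h (-M))) * η := by
  have := abs_sum_sub_sum_le A A' s (fun _ => 1 / (A.card : ℝ)) s' (fun _ => 1 / (A'.card : ℝ))
    g h hM hA hA' hvar (ε := η) (by
      intro t
      have e := hη t
      simpa only [cdf, Finset.mul_sum, mul_ite, mul_one, mul_zero] using e)
  simpa only [Finset.mul_sum] using this

/-! ### Order statistics -/

section OrderStatistics

lemma getD_le_iff_lt_countP {L : List ℝ} (hL : L.Pairwise (· ≤ ·)) (v : ℝ) {k : ℕ}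
    (hk : k < L.length) : L.getD k 0 ≤ v ↔ k < L.countP (· ≤ v) := by
  induction L generalizing k with
  | nil => simp at hk
  | cons a L ih =>
    rw [List.pairwise_cons] at hL
    rw [List.countP_cons]
    by_cases hav : a ≤ v
    · cases k with
      | zero => simp [hav]
      | succ k =>
        have := ih hL.2 (k := k) (by simpa using hk)
        simp [hav, ← this]
    · have hzero : L.countP (· ≤ v) = 0 := by
        rw [List.countP_eq_zero]
        intro c hc
        simpa using (not_le.1 hav).trans_le (hL.1 c hc)
      cases k with
      | zero => simp [hav, hzero]
      | succ k =>
        have := ih hL.2 (k := k) (by simpa using hk)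
        rw [hzero] at this
        rw [List.getD_cons_succ, this]
        simp [hav, hzero]

lemma sum_range_getD (L : List ℝ) (F : ℝ → ℝ) :
    ∑ k ∈ Finset.range L.length, F (L.getD k 0) = (L.map F).sum := by
  induction L with
  | nil => simp
  | cons a L ih =>
    rw [List.length_cons, Finset.sum_range_succ']
    simp only [List.getD_cons_succ, List.getD_cons_zero, List.map_cons, List.sum_cons]
    rw [ih, add_comm]

variable (S : Multiset ℝ)

lemma orderStat_succ (k : ℕ) : orderStat S (k + 1) = (S.sort (· ≤ ·)).getD k 0 := by
  simp [orderStat]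

@[simp] lemma orderStat_zero : orderStat S 0 = 0 := by simp [orderStat]

lemma sum_orderStat (F : ℝ → ℝ) :
    ∑ i ∈ Finset.Icc 1 S.card, F (orderStat S i) = (S.map F).sum := by
  have h1 : ∑ i ∈ Finset.Icc 1 S.card, F (orderStat S i) =
      ∑ k ∈ Finset.range (S.sort (· ≤ ·)).length, F ((S.sort (· ≤ ·)).getD k 0) := by
    rw [Multiset.length_sort, Finset.range_eq_Ico,
      ← Finset.sum_congr rfl (fun k _ => congrArg F (orderStat_succ S k)),
      Finset.sum_Ico_add' (fun i => F (orderStat S i))]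
    rfl
  rw [h1, sum_range_getD, ← Multiset.sum_coe, ← Multiset.map_coe, Multiset.sort_eq]

lemma orderStat_le_iff {i : ℕ} (hi : i ∈ Finset.Icc 1 S.card) (v : ℝ) :
    orderStat S i ≤ v ↔ i ≤ S.countP (· ≤ v) := by
  obtain ⟨h1, h2⟩ := Finset.mem_Icc.1 hi
  obtain ⟨k, rfl⟩ : ∃ k, i = k + 1 := ⟨i - 1, by omega⟩
  have hcount : S.countP (· ≤ v) = (S.sort (· ≤ ·)).countP (· ≤ v) := by
    conv_lhs => rw [← Multiset.sort_eq S (· ≤ ·)]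
    exact Multiset.coe_countP _ _
  rw [orderStat_succ, hcount, Nat.succ_le_iff]
  exact getD_le_iff_lt_countP (Multiset.pairwise_sort S (· ≤ ·)) v
    (by rw [Multiset.length_sort]; omega)

lemma orderStat_mono {i j : ℕ} (hi : 1 ≤ i) (hij : i ≤ j) (hj : j ≤ S.card) :
    orderStat S i ≤ orderStat S j := by
  rw [orderStat_le_iff S (Finset.mem_Icc.2 ⟨hi, hij.trans hj⟩)]
  exact hij.trans ((orderStat_le_iff S (Finset.mem_Icc.2 ⟨hi.trans hij, hj⟩) _).1 le_rfl)

/-- The reason for the tie-breaking rule: `i*/n` becomes the empirical distribution function at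
`s_(i)`, so the kernel weight depends on the value and not on the index. -/
lemma lastTie_eq {i : ℕ} (hi : i ∈ Finset.Icc 1 S.card) :
    lastTie S i = S.countP (· ≤ orderStat S i) := by
  have h1 : i ≤ S.countP (· ≤ orderStat S i) := (orderStat_le_iff S hi _).1 le_rfl
  have hc : S.countP (· ≤ orderStat S i) ∈ Finset.Icc 1 S.card :=
    Finset.mem_Icc.2 ⟨(Finset.mem_Icc.1 hi).1.trans h1, Multiset.countP_le_card _ _⟩
  refine le_antisymm (Finset.sup_le fun j hj => ?_) ?_
  · obtain ⟨hj1, hj2⟩ := Finset.mem_filter.1 hj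
    exact (orderStat_le_iff S hj1 _).1 hj2.le
  · refine Finset.le_sup (f := id) (Finset.mem_filter.2 ⟨hc, le_antisymm ?_ ?_⟩)
    · exact (orderStat_le_iff S hc _).2 le_rfl
    · exact orderStat_mono S (Finset.mem_Icc.1 hi).1 h1 (Finset.mem_Icc.1 hc).2

lemma orderStat_mem {i : ℕ} (hi : i ∈ Finset.Icc 1 S.card) : orderStat S i ∈ S := by
  obtain ⟨h1, h2⟩ := Finset.mem_Icc.1 hi
  obtain ⟨k, rfl⟩ : ∃ k, i = k + 1 := ⟨i - 1, by omega⟩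
  have hk : k < (S.sort (· ≤ ·)).length := by rw [Multiset.length_sort]; omega
  rw [orderStat_succ, List.getD_eq_getElem _ _ hk, ← Multiset.mem_sort (· ≤ ·)]
  exact List.getElem_mem _

end OrderStatistics

/-! ### Stability of the kernel estimator -/

lemma kernelEstimator_eq {ι : Type*} (φ : ℝ → ℝ) (h c : ℝ) (A : Finset ι) (s : ι → ℝ) :
    kernelEstimator φ h c (A.val.map s) =
      (1 / (A.card : ℝ)) * ∑ i ∈ A, scaledKernel φ h (cdf A s (s i) - c) * s i := by
  set S := A.val.map s with hS
  have hcard : S.card = A.card := by simp [hS]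
  have hcdf : ∀ v, (S.countP (· ≤ v) : ℝ) / S.card = cdf A s v := by
    intro v
    rw [hcard, cdf, hS, Multiset.countP_map, Finset.sum_boole, div_eq_inv_mul, one_div]
    rfl
  have h1 : ∑ i ∈ Finset.Icc 1 S.card,
      scaledKernel φ h ((lastTie S i : ℝ) / S.card - c) * orderStat S i =
      ∑ i ∈ Finset.Icc 1 S.card,
        (fun v => scaledKernel φ h (cdf A s v - c) * v) (orderStat S i) := by
    refine Finset.sum_congr rfl fun i hi => ?_
    rw [lastTie_eq S hi, hcdf]
  rw [kernelEstimator, h1,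
    sum_orderStat S (fun v => scaledKernel φ h (cdf A s v - c) * v), hcard, hS, Multiset.map_map]
  rfl

/-- An estimator is stable on families of reals in `[-M, M]` if it is bounded there by `Q` and
depends on nonempty families in a Lipschitz way through their distribution functions, up to
`r` times the reciprocals of the sizes. -/
def IsStable (q : Multiset ℝ → ℝ) (r M Q K : ℝ) : Prop :=
  (∀ {ι : Type} (A : Finset ι) (s : ι → ℝ), (∀ i ∈ A, |s i| ≤ M) → |q (A.val.map s)| ≤ Q) ∧
  ∀ {ι ι' : Type} (A : Finset ι) (A' : Finset ι') (s : ι → ℝ) (s' : ι' → ℝ) (η : ℝ),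
    A.Nonempty → A'.Nonempty → (∀ i ∈ A, |s i| ≤ M) → (∀ j ∈ A', |s' j| ≤ M) →
    (∀ t, |cdf A s t - cdf A' s' t| ≤ η) →
    |q (A.val.map s) - q (A'.val.map s')| ≤ K * (η + r * (1 / A.card + 1 / A'.card))

/-- With `F` the distribution function of the first family, `v ↦ ψ (F v) v` may jump but has bounded
variation, since `F` is monotone with values in `[0, 1]`. Comparing the means of this function over
both families, and then replacing `F` by `F'` in the second mean, costs a multiple of `η` each. No
rounding occurs, hence `r = 0`. -/
lemma kernelEstimator_isStable {φ : ℝ → ℝ} {h : ℝ} (c : ℝ) (hh : 0 < h) {B : ℝ}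
    (hB : ∀ t, |φ t| ≤ B) {Λ : NNReal} (hΛ : LipschitzWith Λ φ) {M : ℝ} (hM : 0 ≤ M) :
    ∃ Q K : ℝ, 0 ≤ Q ∧ 0 ≤ K ∧ IsStable (kernelEstimator φ h c) 0 M Q K := by
  have hB0 : 0 ≤ B := (abs_nonneg _).trans (hB 0)
  set ψ : ℝ → ℝ := fun u => scaledKernel φ h (u - c) with hψ
  set b := B / h with hb
  set l := (Λ : ℝ) / h ^ 2 with hl
  have hb0 : 0 ≤ b := by positivity
  have hl0 : 0 ≤ l := by positivity
  have hψb : ∀ u, |ψ u| ≤ b := fun u => by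
    simp only [hψ, scaledKernel]
    rw [abs_mul, abs_of_pos (by positivity : 0 < 1 / h), hb, div_eq_mul_one_div B, mul_comm B]
    exact mul_le_mul_of_nonneg_left (hB _) (by positivity)
  have hψl : ∀ u v, |ψ u - ψ v| ≤ l * |u - v| := fun u v => by
    simp only [hψ, scaledKernel]
    have h1 := hΛ.dist_le_mul ((u - c) / h) ((v - c) / h)
    rw [Real.dist_eq, Real.dist_eq] at h1
    have h2 : (u - c) / h - (v - c) / h = (1 / h) * (u - v) := by field_simp; ring
    rw [h2, abs_mul, abs_of_pos (by positivity : 0 < 1 / h)] at h1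
    rw [← mul_sub, abs_mul, abs_of_pos (by positivity : 0 < 1 / h)]
    calc 1 / h * |φ ((u - c) / h) - φ ((v - c) / h)| ≤ 1 / h * (Λ * (1 / h * |u - v|)) :=
          mul_le_mul_of_nonneg_left h1 (by positivity)
      _ = l * |u - v| := by rw [hl]; field_simp
  refine ⟨b * M, (b * M + (b * M - b * -M + M * l)) + l * M, by positivity, ?_, ?_, ?_⟩
  · nlinarith [mul_nonneg hb0 hM, mul_nonneg hl0 hM]
  · intro ι A s hs
    rw [kernelEstimator_eq]
    refine abs_mean_le _ _ (by positivity) fun i hi => ?_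
    rw [abs_mul]
    exact mul_le_mul (hψb _) (hs i hi) (abs_nonneg _) hb0
  · intro ι ι' A A' s s' η _ _ hs hs' hη
    have hη0 : 0 ≤ η := (abs_nonneg _).trans (hη 0)
    rw [kernelEstimator_eq, kernelEstimator_eq]
    let g : ℝ → ℝ := fun v => ψ (cdf A s v) * v
    let H : ℝ → ℝ := fun v => b * v + M * l * cdf A s v
    have h1 := abs_mean_sub_mean_le A A' s s' g H hM hs hs' (by
      intro p q hp hpq hq
      have e1 : g p - g q = ψ (cdf A s p) * (p - q) + q * (ψ (cdf A s p) - ψ (cdf A s q)) := by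
        simp only [g]; ring
      have e2 := cdf_mono A s hpq
      have hqM : |q| ≤ M := abs_le.2 ⟨hp.trans hpq, hq⟩
      calc |g p - g q| ≤ |ψ (cdf A s p)| * |p - q| + |q| * |ψ (cdf A s p) - ψ (cdf A s q)| := by
            rw [e1, ← abs_mul, ← abs_mul]; exact abs_add_le _ _
        _ ≤ b * |p - q| + M * (l * |cdf A s p - cdf A s q|) := by
            gcongr
            · exact hψb _
            · exact hψl _ _
        _ = H q - H p := by
            rw [abs_sub_comm p q, abs_sub_comm (cdf A s p), abs_of_nonneg (sub_nonneg.2 hpq),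
              abs_of_nonneg (sub_nonneg.2 e2)]
            simp only [H]; ring) hη
    have h2 : |g M| + (H M - H (-M)) ≤ b * M + (b * M - b * -M + M * l) := by
      have e1 : |g M| ≤ b * M := by
        simp only [g]
        rw [abs_mul, abs_of_nonneg hM]
        exact mul_le_mul_of_nonneg_right (hψb _) hM
      have e2 : H M - H (-M) ≤ b * M - b * -M + M * l := by
        have : cdf A s M - cdf A s (-M) ≤ 1 := by
          linarith [cdf_le_one A s M, cdf_nonneg A s (-M)]
        have := mul_le_mul_of_nonneg_left this (mul_nonneg hM hl0)
        simp only [H]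
        linarith
      linarith
    have h3 : |(1 / (A'.card : ℝ)) * ∑ j ∈ A', g (s' j) -
        (1 / (A'.card : ℝ)) * ∑ j ∈ A', ψ (cdf A' s' (s' j)) * s' j| ≤ l * M * η := by
      rw [← mul_sub, ← Finset.sum_sub_distrib]
      refine abs_mean_le _ _ (by positivity) fun j hj => ?_
      simp only [g]
      rw [← sub_mul, abs_mul]
      calc |ψ (cdf A s (s' j)) - ψ (cdf A' s' (s' j))| * |s' j| ≤ (l * η) * M := by
            refine mul_le_mul ((hψl _ _).trans ?_) (hs' j hj) (abs_nonneg _) (by positivity)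
            exact mul_le_mul_of_nonneg_left (hη _) hl0
        _ = _ := by ring
    have h4 := mul_le_mul_of_nonneg_right h2 hη0
    have h5 := (abs_sub_le _ _ _).trans (add_le_add (h1.trans h4) h3)
    refine h5.trans (le_of_eq ?_)
    ring

/-! ### Stability of the interval estimator -/

/-- The sum of the `m` smallest members of a finite family. -/
noncomputable def lowerSum (S : Multiset ℝ) (m : ℕ) : ℝ := ∑ i ∈ Finset.Icc 1 m, orderStat S i

/-- Truncated subtraction is harmless at `p = 0`, because `s_(0) = 0`. -/
lemma sum_Icc_orderStat (S : Multiset ℝ) {p q : ℕ} (hpq : p ≤ q) :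
    ∑ i ∈ Finset.Icc p q, orderStat S i = lowerSum S q - lowerSum S (p - 1) := by
  rcases p with _ | p
  · have : Finset.Icc 0 q = insert 0 (Finset.Icc 1 q) := by
      ext i; simp only [Finset.mem_Icc, Finset.mem_insert]; omega
    rw [this, Finset.sum_insert (by simp)]
    simp [lowerSum]
  · have h1 : Finset.Icc 1 q = Finset.Icc 1 p ∪ Finset.Icc (p + 1) q := by
      ext i; simp only [Finset.mem_Icc, Finset.mem_union]; omega
    have h2 : Disjoint (Finset.Icc 1 p) (Finset.Icc (p + 1) q) := by
      rw [Finset.disjoint_left]; intro i; simp only [Finset.mem_Icc]; omega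
    simp only [lowerSum, Nat.add_sub_cancel]
    rw [h1, Finset.sum_union h2]
    ring

/-- One half of the duality `lowerSum S m = max_t (m t - ∑ (t - s)₊)`; `exists_lowerSum_eq` gives
attainment, at `t = s_(m)` if `m > 0`. Single quantiles are not Lipschitz in the distribution
function, but the dual objective is. -/
lemma mul_sub_sum_max_le_lowerSum (S : Multiset ℝ) {m : ℕ} (hm : m ≤ S.card) (t : ℝ) :
    m * t - (S.map fun s => max (t - s) 0).sum ≤ lowerSum S m := by
  rw [← sum_orderStat S]
  have h1 : ∑ i ∈ Finset.Icc 1 m, (t - orderStat S i) ≤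
      ∑ i ∈ Finset.Icc 1 S.card, max (t - orderStat S i) 0 :=
    (Finset.sum_le_sum fun i _ => le_max_left _ _).trans
      (Finset.sum_le_sum_of_subset_of_nonneg (Finset.Icc_subset_Icc_right hm)
        fun _ _ _ => le_max_right _ _)
  rw [Finset.sum_sub_distrib, Finset.sum_const, Nat.card_Icc, nsmul_eq_mul,
    Nat.add_sub_cancel] at h1
  simp only [lowerSum]
  linarith

lemma exists_lowerSum_eq (S : Multiset ℝ) {m : ℕ} (hm : m ≤ S.card) {M : ℝ} (hM : 0 ≤ M)
    (hS : ∀ s ∈ S, |s| ≤ M) :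
    ∃ t, |t| ≤ M ∧ lowerSum S m = m * t - (S.map fun s => max (t - s) 0).sum := by
  rcases Nat.eq_zero_or_pos m with rfl | hpos
  · refine ⟨-M, by rw [abs_neg, abs_of_nonneg hM], ?_⟩
    have : S.map (fun s => max (-M - s) 0) = S.map fun _ => (0 : ℝ) := by
      refine Multiset.map_congr rfl fun s hs => max_eq_right ?_
      linarith [(abs_le.1 (hS s hs)).1]
    simp [lowerSum, this]
  · have hmem : m ∈ Finset.Icc 1 S.card := Finset.mem_Icc.2 ⟨hpos, hm⟩
    refine ⟨orderStat S m, hS _ (orderStat_mem S hmem), ?_⟩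
    rw [← sum_orderStat S (fun s => max (orderStat S m - s) 0)]
    have h1 : ∑ i ∈ Finset.Icc 1 S.card, max (orderStat S m - orderStat S i) 0 =
        ∑ i ∈ Finset.Icc 1 m, (orderStat S m - orderStat S i) := by
      rw [← Finset.sum_subset (Finset.Icc_subset_Icc_right hm)]
      · refine Finset.sum_congr rfl fun i hi => max_eq_left ?_
        obtain ⟨hi1, hi2⟩ := Finset.mem_Icc.1 hi
        exact sub_nonneg.2 (orderStat_mono S hi1 hi2 hm)
      · intro i hi hi'
        rw [Finset.mem_Icc] at hi hi'
        exact max_eq_right (sub_nonpos.2 (orderStat_mono S hpos (by omega) hi.2))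
    rw [h1, Finset.sum_sub_distrib, Finset.sum_const, Nat.card_Icc, nsmul_eq_mul,
      Nat.add_sub_cancel]
    simp only [lowerSum]
    ring

lemma abs_lowerSum_le (S : Multiset ℝ) {m : ℕ} (hm : m ≤ S.card) {M : ℝ}
    (hS : ∀ s ∈ S, |s| ≤ M) : |lowerSum S m| ≤ m * M := by
  refine (Finset.abs_sum_le_sum_abs _ _).trans ?_
  refine (Finset.sum_le_card_nsmul _ _ M fun i hi => ?_).trans (by simp)
  obtain ⟨h1, h2⟩ := Finset.mem_Icc.1 hi
  exact hS _ (orderStat_mem S (Finset.mem_Icc.2 ⟨h1, h2.trans hm⟩))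

/-- The optimal `t` for `S` is inserted as a competitor in the dual problem for `S'`. -/
lemma lowerSum_div_sub_le {S S' : Multiset ℝ} {m m' : ℕ} (hm : m ≤ S.card) (hm' : m' ≤ S'.card)
    {M e : ℝ} (hM : 0 ≤ M) (hS : ∀ s ∈ S, |s| ≤ M) (hn : 0 < S.card) (hn' : 0 < S'.card)
    (he : ∀ t, |t| ≤ M → (1 / (S'.card : ℝ)) * (S'.map fun s => max (t - s) 0).sum -
      (1 / (S.card : ℝ)) * (S.map fun s => max (t - s) 0).sum ≤ e) :
    lowerSum S m / S.card - lowerSum S' m' / S'.card ≤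
      e + M * |(m : ℝ) / S.card - m' / S'.card| := by
  obtain ⟨t, ht, hmt⟩ := exists_lowerSum_eq S hm hM hS
  have hn0 : (0 : ℝ) < S.card := by exact_mod_cast hn
  have hn0' : (0 : ℝ) < S'.card := by exact_mod_cast hn'
  have h1 := div_le_div_of_nonneg_right (mul_sub_sum_max_le_lowerSum S' hm' t) hn0'.le
  have h2 := he t ht
  have h3 : ((m : ℝ) / S.card - m' / S'.card) * t ≤ M * |(m : ℝ) / S.card - m' / S'.card| := by
    refine (le_abs_self _).trans ?_
    rw [abs_mul, mul_comm]
    exact mul_le_mul_of_nonneg_right ht (abs_nonneg _)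
  rw [hmt]
  have e1 : ((m : ℝ) * t - (S.map fun s => max (t - s) 0).sum) / S.card =
      (m : ℝ) / S.card * t - (1 / (S.card : ℝ)) * (S.map fun s => max (t - s) 0).sum := by ring
  have e2 : ((m' : ℝ) * t - (S'.map fun s => max (t - s) 0).sum) / S'.card =
      (m' : ℝ) / S'.card * t - (1 / (S'.card : ℝ)) * (S'.map fun s => max (t - s) 0).sum := by ring
  rw [e1]
  rw [e2] at h1
  linarith

lemma abs_lowerSum_div_sub_le {ι ι' : Type*} (A : Finset ι) (A' : Finset ι') (s : ι → ℝ)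
    (s' : ι' → ℝ) {M η : ℝ} (hM : 0 ≤ M) (hne : A.Nonempty) (hne' : A'.Nonempty)
    (hA : ∀ i ∈ A, |s i| ≤ M) (hA' : ∀ j ∈ A', |s' j| ≤ M)
    (hη : ∀ t, |cdf A s t - cdf A' s' t| ≤ η) {m m' : ℕ} (hm : m ≤ A.card) (hm' : m' ≤ A'.card) :
    |lowerSum (A.val.map s) m / A.card - lowerSum (A'.val.map s') m' / A'.card| ≤
      2 * M * η + M * |(m : ℝ) / A.card - m' / A'.card| := by
  have hU : ∀ t, |t| ≤ M → |(1 / (A.card : ℝ)) * ∑ i ∈ A, max (t - s i) 0 -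
      (1 / (A'.card : ℝ)) * ∑ j ∈ A', max (t - s' j) 0| ≤ 2 * M * η := by
    intro t ht
    have h1 := abs_mean_sub_mean_le A A' s s' (fun v => max (t - v) 0) id hM hA hA' (by
      intro p q _ hpq _
      refine (abs_max_sub_max_le_abs _ _ _).trans (le_of_eq ?_)
      rw [show t - p - (t - q) = q - p by ring, abs_of_nonneg (sub_nonneg.2 hpq)]
      rfl) hη
    refine h1.trans (le_of_eq ?_)
    rw [max_eq_right (by linarith [(abs_le.1 ht).2] : t - M ≤ 0)]
    simp only [abs_zero, id]
    ring
  have hS : ∀ v ∈ A.val.map s, |v| ≤ M := by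
    intro v hv
    obtain ⟨i, hi, rfl⟩ := Multiset.mem_map.1 hv
    exact hA i hi
  have hS' : ∀ v ∈ A'.val.map s', |v| ≤ M := by
    intro v hv
    obtain ⟨i, hi, rfl⟩ := Multiset.mem_map.1 hv
    exact hA' i hi
  have hc : (A.val.map s).card = A.card := by simp
  have hc' : (A'.val.map s').card = A'.card := by simp
  have h1 := lowerSum_div_sub_le (S := A.val.map s) (S' := A'.val.map s') (m := m) (m' := m')
    (e := 2 * M * η) (by rwa [hc]) (by rwa [hc']) hM hS (by rw [hc]; exact hne.card_pos)
    (by rw [hc']; exact hne'.card_pos) (fun t ht => by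
      rw [hc, hc', Multiset.map_map, Multiset.map_map]
      have := (abs_le.1 (hU t ht)).1
      have : (1 / (A'.card : ℝ)) * ∑ j ∈ A', max (t - s' j) 0 -
        (1 / (A.card : ℝ)) * ∑ i ∈ A, max (t - s i) 0 ≤ 2 * M * η := by linarith
      exact this)
  have h2 := lowerSum_div_sub_le (S := A'.val.map s') (S' := A.val.map s) (m := m') (m' := m)
    (e := 2 * M * η) (by rwa [hc']) (by rwa [hc]) hM hS' (by rw [hc']; exact hne'.card_pos)
    (by rw [hc]; exact hne.card_pos) (fun t ht => by
      rw [hc, hc', Multiset.map_map, Multiset.map_map]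
      exact (abs_le.1 (hU t ht)).2)
  rw [hc, hc'] at h1 h2
  rw [abs_sub_comm ((m' : ℝ) / _)] at h2
  exact abs_le.2 ⟨by linarith, h1⟩

/-- The interval estimator up to rounding: a normalized difference of lower sums. -/
noncomputable def roundedInterval (k₁ k₂ : ℝ) (S : Multiset ℝ) : ℝ :=
  (lowerSum S ⌊(S.card : ℝ) * k₂⌋₊ / S.card -
    lowerSum S (⌊(S.card : ℝ) * k₁⌋₊ - 1) / S.card) / (k₂ - k₁)

lemma floor_mul_le_card {k : ℝ} (hk : k ≤ 1) (n : ℕ) : ⌊(n : ℝ) * k⌋₊ ≤ n :=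
  Nat.floor_le_of_le (mul_le_of_le_one_right (Nat.cast_nonneg n) hk)

lemma abs_lowerSum_div_le {S : Multiset ℝ} {m : ℕ} (hm : m ≤ S.card) {M : ℝ} (hM : 0 ≤ M)
    (hS : ∀ s ∈ S, |s| ≤ M) : |lowerSum S m / S.card| ≤ M := by
  rw [abs_div, Nat.abs_cast]
  refine div_le_of_le_mul₀ (Nat.cast_nonneg _) hM ((abs_lowerSum_le S hm hS).trans ?_)
  rw [mul_comm]
  exact mul_le_mul_of_nonneg_left (by exact_mod_cast hm) hM

section Interval

variable {k₁ k₂ : ℝ} {S : Multiset ℝ} {M : ℝ}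

lemma abs_roundedInterval_le (h12 : k₁ < k₂) (h2 : k₂ ≤ 1) (hM : 0 ≤ M) (hS : ∀ s ∈ S, |s| ≤ M) :
    |roundedInterval k₁ k₂ S| ≤ 2 * M / (k₂ - k₁) := by
  have hκ : 0 < k₂ - k₁ := sub_pos.2 h12
  rw [roundedInterval, abs_div, abs_of_pos hκ]
  refine div_le_div_of_nonneg_right ((abs_sub _ _).trans ?_) hκ.le
  have e1 := abs_lowerSum_div_le (floor_mul_le_card h2 S.card) hM hS
  have e2 := abs_lowerSum_div_le (m := ⌊(S.card : ℝ) * k₁⌋₊ - 1) ((Nat.sub_le _ _).trans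
    (floor_mul_le_card (h12.le.trans h2) S.card)) hM hS
  linarith

lemma abs_intervalEstimator_sub_le (h12 : k₁ < k₂) (h2 : k₂ ≤ 1) (hM : 0 ≤ M)
    (hS : ∀ s ∈ S, |s| ≤ M) (hn : 0 < S.card) :
    |intervalEstimator k₁ k₂ S - (|roundedInterval k₁ k₂ S|)| ≤
      4 * M / (k₂ - k₁) ^ 2 * (1 / S.card) := by
  have hκ : 0 < k₂ - k₁ := sub_pos.2 h12
  have hn0 : (0 : ℝ) < S.card := by exact_mod_cast hn
  have hfl : ⌊(S.card : ℝ) * k₁⌋₊ ≤ ⌊(S.card : ℝ) * k₂⌋₊ :=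
    Nat.floor_le_floor (mul_le_mul_of_nonneg_left h12.le hn0.le)
  have hround := abs_roundedInterval_le (S := S) h12 h2 hM hS
  have hnum : (S.card : ℝ) * (k₂ - k₁) * roundedInterval k₁ k₂ S =
      lowerSum S ⌊(S.card : ℝ) * k₂⌋₊ - lowerSum S (⌊(S.card : ℝ) * k₁⌋₊ - 1) := by
    rw [roundedInterval]; field_simp
  rw [intervalEstimator, sum_Icc_orderStat S hfl, ← hnum]
  refine (abs_abs_sub_abs_le_abs_sub _ _).trans ?_
  set f := ⌊(S.card : ℝ) * (k₂ - k₁)⌋₊ with hf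
  set ρ := roundedInterval k₁ k₂ S
  have hx0 : 0 < (S.card : ℝ) * (k₂ - k₁) := by positivity
  have hf1 : (f : ℝ) ≤ S.card * (k₂ - k₁) := Nat.floor_le hx0.le
  have hf2 : (S.card : ℝ) * (k₂ - k₁) < f + 1 := Nat.lt_floor_add_one _
  have hfac : |1 / (f : ℝ) * ((S.card : ℝ) * (k₂ - k₁)) - 1| ≤ 2 / (S.card * (k₂ - k₁)) := by
    -- If the floor vanishes, `1 / 0 = 0` makes the estimator `0`; the relative error `1` is then
    -- still admissible because `n (k₂ - k₁) < 1`.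
    rcases Nat.eq_zero_or_pos f with hf0 | hf0
    · rw [hf0] at hf2 ⊢
      simp only [Nat.cast_zero, div_zero, zero_mul, zero_sub, abs_neg, abs_one, zero_add] at hf2 ⊢
      rw [le_div_iff₀ hx0]
      linarith
    · have hfpos : (1 : ℝ) ≤ f := by exact_mod_cast hf0
      have e1 : 1 / (f : ℝ) * ((S.card : ℝ) * (k₂ - k₁)) - 1 =
          ((S.card : ℝ) * (k₂ - k₁) - f) / f := by field_simp
      rw [e1, abs_of_nonneg (div_nonneg (by linarith) (by linarith)), div_le_div_iff₀
        (by linarith) hx0]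
      nlinarith
  have e2 : 1 / (f : ℝ) * ((S.card : ℝ) * (k₂ - k₁) * ρ) - ρ =
      (1 / (f : ℝ) * ((S.card : ℝ) * (k₂ - k₁)) - 1) * ρ := by ring
  rw [e2, abs_mul]
  calc |1 / (f : ℝ) * ((S.card : ℝ) * (k₂ - k₁)) - 1| * |ρ| ≤
      2 / (S.card * (k₂ - k₁)) * (2 * M / (k₂ - k₁)) := by gcongr
    _ = _ := by field_simp; ring

end Interval

lemma abs_floor_div_sub_le {k : ℝ} (hk : 0 ≤ k) {n : ℕ} (hn : 0 < n) (c : ℕ) :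
    |((⌊(n : ℝ) * k⌋₊ - c : ℕ) : ℝ) / n - k| ≤ (c + 1) * (1 / n) := by
  have hn0 : (0 : ℝ) < n := by exact_mod_cast hn
  have h1 : (⌊(n : ℝ) * k⌋₊ : ℝ) ≤ n * k := Nat.floor_le (by positivity)
  have h2 : (n : ℝ) * k < ⌊(n : ℝ) * k⌋₊ + 1 := Nat.lt_floor_add_one _
  have h3 : ((⌊(n : ℝ) * k⌋₊ - c : ℕ) : ℝ) ≤ ⌊(n : ℝ) * k⌋₊ := by
    exact_mod_cast Nat.sub_le _ _
  have h4 : (⌊(n : ℝ) * k⌋₊ : ℝ) ≤ ((⌊(n : ℝ) * k⌋₊ - c : ℕ) : ℝ) + c := by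
    have : ⌊(n : ℝ) * k⌋₊ ≤ (⌊(n : ℝ) * k⌋₊ - c) + c := by omega
    exact_mod_cast this
  have e : ((⌊(n : ℝ) * k⌋₊ - c : ℕ) : ℝ) / n - k =
      (((⌊(n : ℝ) * k⌋₊ - c : ℕ) : ℝ) - n * k) * (1 / n) := by field_simp
  rw [e, abs_mul, abs_of_pos (by positivity : 0 < 1 / (n : ℝ))]
  refine mul_le_mul_of_nonneg_right (abs_le.2 ⟨by linarith, ?_⟩) (by positivity)
  have : (0 : ℝ) ≤ c := Nat.cast_nonneg c
  linarith

lemma intervalEstimator_isStable {k₁ k₂ : ℝ} (h1 : 0 < k₁) (h12 : k₁ < k₂) (h2 : k₂ ≤ 1) {M : ℝ}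
    (hM : 0 ≤ M) :
    ∃ Q K : ℝ, 0 ≤ Q ∧ 0 ≤ K ∧ IsStable (intervalEstimator k₁ k₂) 1 M Q K := by
  have hκ : 0 < k₂ - k₁ := sub_pos.2 h12
  have hmap : ∀ {ι : Type} (A : Finset ι) (s : ι → ℝ), (∀ i ∈ A, |s i| ≤ M) →
      ∀ v ∈ A.val.map s, |v| ≤ M := by
    intro ι A s hs v hv
    obtain ⟨i, hi, rfl⟩ := Multiset.mem_map.1 hv
    exact hs i hi
  set D := 4 * M / (k₂ - k₁) ^ 2 with hD
  have hD0 : 0 ≤ D := by positivity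
  refine ⟨2 * M / (k₂ - k₁) + D, 4 * M / (k₂ - k₁) + D, by positivity, by positivity, ?_, ?_⟩
  · intro ι A s hs
    rcases A.eq_empty_or_nonempty with rfl | hne
    · have : intervalEstimator k₁ k₂ ((∅ : Finset ι).val.map s) = 0 := by
        simp [intervalEstimator]
      rw [this, abs_zero]; positivity
    · have hc : 0 < (A.val.map s).card := by simpa using hne.card_pos
      have e1 := abs_intervalEstimator_sub_le h12 h2 hM (hmap A s hs) hc
      have e2 := abs_roundedInterval_le h12 h2 hM (hmap A s hs)
      have e3 : 1 / ((A.val.map s).card : ℝ) ≤ 1 := by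
        rw [div_le_one (by exact_mod_cast hc)]; exact_mod_cast hc
      have e4 := mul_le_mul_of_nonneg_left e3 hD0
      have e5 := abs_sub_abs_le_abs_sub (intervalEstimator k₁ k₂ (A.val.map s))
        |roundedInterval k₁ k₂ (A.val.map s)|
      rw [abs_abs] at e5
      linarith
  · intro ι ι' A A' s s' η hne hne' hs hs' hη
    have hη0 : 0 ≤ η := (abs_nonneg _).trans (hη 0)
    have hcard : (A.val.map s).card = A.card := by simp
    have hcard' : (A'.val.map s').card = A'.card := by simp
    have e1 := abs_intervalEstimator_sub_le h12 h2 hM (hmap A s hs) (by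
      rw [hcard]; exact hne.card_pos)
    have e2 := abs_intervalEstimator_sub_le h12 h2 hM (hmap A' s' hs') (by
      rw [hcard']; exact hne'.card_pos)
    rw [hcard] at e1
    rw [hcard'] at e2
    set a := 1 / (A.card : ℝ)
    set a' := 1 / (A'.card : ℝ)
    have e3 := abs_lowerSum_div_sub_le A A' s s' hM hne hne' hs hs' hη
      (floor_mul_le_card h2 A.card) (floor_mul_le_card h2 A'.card)
    have e4 := abs_lowerSum_div_sub_le A A' s s' hM hne hne' hs hs' hη
      (m := ⌊(A.card : ℝ) * k₁⌋₊ - 1) (m' := ⌊(A'.card : ℝ) * k₁⌋₊ - 1)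
      ((Nat.sub_le _ _).trans (floor_mul_le_card (h12.le.trans h2) A.card))
      ((Nat.sub_le _ _).trans (floor_mul_le_card (h12.le.trans h2) A'.card))
    have f1 := abs_floor_div_sub_le (h1.trans h12).le hne.card_pos 0
    have f2 := abs_floor_div_sub_le (h1.trans h12).le hne'.card_pos 0
    -- The offset `1` comes from the lower summation limit `⌊n k₁⌋`, which is included in the sum.
    have f3 := abs_floor_div_sub_le h1.le hne.card_pos 1
    have f4 := abs_floor_div_sub_le h1.le hne'.card_pos 1
    simp only [Nat.sub_zero, Nat.cast_zero, zero_add, one_mul] at f1 f2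
    rw [abs_sub_comm] at f2 f4
    have g1 := mul_le_mul_of_nonneg_left ((abs_sub_le _ _ _).trans (add_le_add f1 f2)) hM
    have g2 := mul_le_mul_of_nonneg_left ((abs_sub_le _ _ _).trans (add_le_add f3 f4)) hM
    have e5 : |roundedInterval k₁ k₂ (A.val.map s) - roundedInterval k₁ k₂ (A'.val.map s')| ≤
        4 * M / (k₂ - k₁) * (η + (a + a')) := by
      simp only [roundedInterval, hcard, hcard']
      rw [← sub_div, abs_div, abs_of_pos hκ, div_le_iff₀ hκ, sub_sub_sub_comm]
      refine (abs_sub _ _).trans ?_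
      have e6 : 4 * M / (k₂ - k₁) * (η + (a + a')) * (k₂ - k₁) = 4 * M * (η + (a + a')) := by
        field_simp
      rw [e6]
      have ha : 0 ≤ M * (a + a') := by positivity
      push_cast at g1 g2
      linarith
    have e7 := (abs_abs_sub_abs_le_abs_sub _ _).trans e5
    rw [abs_sub_comm] at e2
    have e8 := (abs_sub_le _ _ _).trans (add_le_add ((abs_sub_le _ _ _).trans
      (add_le_add e1 e7)) e2)
    refine e8.trans ?_
    have : 0 ≤ D * η := by positivity
    linarith

/-! ### From half-space masses to the losses -/

lemma exists_lipschitz_bound {l : ℝ → ℝ} (hl : LocallyLipschitz l) {T : ℝ} (hT : 0 ≤ T) :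
    ∃ Λ B : ℝ, 0 ≤ Λ ∧ 0 ≤ B ∧ (∀ u, |u| ≤ T → |l u| ≤ B) ∧
      ∀ u v, |u| ≤ T → |v| ≤ T → |l u - l v| ≤ Λ * |u - v| := by
  obtain ⟨Λ, hΛ⟩ := (hl.locallyLipschitzOn (s := Set.Icc (-T) T)).exists_lipschitzOnWith_of_compact
    isCompact_Icc
  have hlip : ∀ u v, |u| ≤ T → |v| ≤ T → |l u - l v| ≤ Λ * |u - v| := fun u v hu hv =>
    hΛ.dist_le_mul u (abs_le.1 hu) v (abs_le.1 hv)
  refine ⟨Λ, |l 0| + Λ * T, Λ.2, add_nonneg (abs_nonneg _) (mul_nonneg Λ.2 hT), fun u hu => ?_,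
    hlip⟩
  have h1 := hlip u 0 hu (by simpa using hT)
  rw [sub_zero] at h1
  have h2 := mul_le_mul_of_nonneg_left hu Λ.2
  have h3 := abs_sub_abs_le_abs_sub (l u) (l 0)
  simp only [NNReal.val_eq_coe] at h2
  linarith

lemma abs_loss_le {d n : ℕ} {q : Multiset ℝ → ℝ} {l : ℝ → ℝ}
    {x : Fin n → EuclideanSpace ℝ (Fin d)} {y : Fin n → ℝ} {A : Finset (Fin n)}
    {w : EuclideanSpace ℝ (Fin d)} {M Q B : ℝ} (hB0 : 0 ≤ B)
    (hx : ∀ i, |inner ℝ w (x i)| ≤ M) (hy : ∀ i, |y i| ≤ 1)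
    (hq : |q (A.val.map fun j => inner ℝ w (x j))| ≤ Q) (hB : ∀ u, |u| ≤ M + Q → |l u| ≤ B) :
    |loss q l x y A w| ≤ 2 * B := by
  have := abs_mean_le (Finset.univ : Finset (Fin n)) (fun i =>
    (1 - y i) * l (inner ℝ w (x i) - q (A.val.map fun j => inner ℝ w (x j)))) (B := 2 * B)
    (by positivity) (fun i _ => by
      rw [abs_mul]
      refine mul_le_mul ?_ (hB _ ((abs_sub _ _).trans (add_le_add (hx i) hq))) (abs_nonneg _)
        (by norm_num)
      have := abs_le.1 (hy i)
      exact abs_le.2 ⟨by linarith, by linarith⟩)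
  rwa [Finset.card_univ, Fintype.card_fin] at this

section Deviation

variable {d N b : ℕ} {x : Fin N → EuclideanSpace ℝ (Fin d)} {A : Finset (Fin N)}
  {σ : Fin b → Fin N} {w : EuclideanSpace ℝ (Fin d)} {M ε p₀ : ℝ}

lemma abs_card_div_sub_le (hx : ∀ i, |inner ℝ w (x i)| ≤ M)
    (hgap : ∀ t, |massGap x (fun i => if i ∈ A then 1 else 0) σ w t| ≤ ε) :
    |(A.card : ℝ) / N - ((Finset.univ.filter fun j => σ j ∈ A).card : ℝ) / b| ≤ ε := by
  -- At `t = M` the half-space contains every point, so its mass is the proportion of `A`.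
  have h := hgap M
  have hle : ∀ i, inner ℝ w (x i) ≤ M := fun i => (abs_le.1 (hx i)).2
  simp only [massGap, hle, if_true, Finset.sum_boole, Finset.filter_univ_mem] at h
  rwa [one_div_mul_eq_div, one_div_mul_eq_div] at h

lemma abs_cdf_sub_cdf_le (hN : 0 < N) (hb : 0 < b) (hp₀ : 0 < p₀) (hA : p₀ * N ≤ A.card)
    (hne : (Finset.univ.filter fun j => σ j ∈ A).Nonempty)
    (hx : ∀ i, |inner ℝ w (x i)| ≤ M)
    (hgap : ∀ t, |massGap x (fun i => if i ∈ A then 1 else 0) σ w t| ≤ ε) (t : ℝ) :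
    |cdf A (fun i => inner ℝ w (x i)) t -
      cdf (Finset.univ.filter fun j => σ j ∈ A) (fun j => inner ℝ w (x (σ j))) t| ≤
      2 * ε / p₀ := by
  have hN0 : (0 : ℝ) < N := by exact_mod_cast hN
  have hb0 : (0 : ℝ) < b := by exact_mod_cast hb
  set A' := Finset.univ.filter fun j => σ j ∈ A with hA'
  have hAc : (0 : ℝ) < A.card := (by positivity : 0 < p₀ * N).trans_le hA
  have hAc' : (0 : ℝ) < A'.card := by exact_mod_cast hne.card_pos
  have h1 : massGap x (fun i => if i ∈ A then 1 else 0) σ w t =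
      cdf A (fun i => inner ℝ w (x i)) t * (A.card / N) -
        cdf A' (fun j => inner ℝ w (x (σ j))) t * (A'.card / b) := by
    have e1 : (∑ i, if inner ℝ w (x i) ≤ t then (if i ∈ A then (1 : ℝ) else 0) else 0) =
        ∑ i ∈ A, if inner ℝ w (x i) ≤ t then 1 else 0 := by
      rw [← Finset.filter_univ_mem A, Finset.sum_filter]
      refine Finset.sum_congr rfl fun i _ => ?_
      by_cases hi : i ∈ A <;> simp [hi]
    have e2 : (∑ j, if inner ℝ w (x (σ j)) ≤ t then (if σ j ∈ A then (1 : ℝ) else 0) else 0) =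
        ∑ j ∈ A', if inner ℝ w (x (σ j)) ≤ t then 1 else 0 := by
      rw [hA', Finset.sum_filter]
      refine Finset.sum_congr rfl fun j _ => ?_
      split_ifs <;> rfl
    rw [massGap, e1, e2, cdf, cdf]
    field_simp
  have h2 := abs_card_div_sub_le hx hgap
  have h3 := hgap t
  rw [h1] at h3
  have hα : p₀ ≤ (A.card : ℝ) / N := by rwa [le_div_iff₀ hN0]
  set α := (A.card : ℝ) / N
  set α' := (A'.card : ℝ) / b
  set F := cdf A (fun i => inner ℝ w (x i)) t
  set F' := cdf A' (fun j => inner ℝ w (x (σ j))) t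
  have hF'0 : 0 ≤ F' := cdf_nonneg _ _ _
  have hF'1 : F' ≤ 1 := cdf_le_one _ _ _
  -- Only the population proportion `α ≥ p₀` is divided by; the sample proportion needs no lower
  -- bound here.
  have e : (F - F') * α = (F * α - F' * α') - F' * (α - α') := by ring
  have h4 : |F - F'| * α ≤ 2 * ε := by
    have hα0 : 0 < α := hp₀.trans_le hα
    rw [← abs_of_pos hα0, ← abs_mul, e]
    refine (abs_sub _ _).trans ?_
    have : |F' * (α - α')| ≤ 1 * ε := by
      rw [abs_mul, abs_of_nonneg hF'0]
      exact mul_le_mul hF'1 h2 (abs_nonneg _) zero_le_one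
    linarith
  rw [le_div_iff₀ hp₀]
  exact (mul_le_mul_of_nonneg_left hα (abs_nonneg _)).trans h4

lemma abs_estimator_sub_le {q : Multiset ℝ → ℝ} {r Q K : ℝ} (hr : 0 ≤ r) (hK : 0 ≤ K)
    (hq : IsStable q r M Q K) (hN : 0 < N) (hb : 0 < b) (hbN : r = 0 ∨ b ≤ N) (hp₀ : 0 < p₀)
    (hA : p₀ * N ≤ A.card) (hx : ∀ i, |inner ℝ w (x i)| ≤ M)
    (hgap : ∀ t, |massGap x (fun i => if i ∈ A then 1 else 0) σ w t| ≤ ε) (hε : ε < p₀ / 2) :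
    |q (A.val.map fun i => inner ℝ w (x i)) -
      q ((Finset.univ.filter fun j => σ j ∈ A).val.map fun j => inner ℝ w (x (σ j)))| ≤
      K * (3 / p₀) * (ε + r * (1 / b)) := by
  have hN0 : (0 : ℝ) < N := by exact_mod_cast hN
  have hb0 : (0 : ℝ) < b := by exact_mod_cast hb
  have hε0 : 0 ≤ ε := (abs_nonneg _).trans (hgap 0)
  have hAc : (0 : ℝ) < A.card := (by positivity : 0 < p₀ * N).trans_le hA
  have hne : A.Nonempty := Finset.card_pos.1 (by exact_mod_cast hAc)
  set A' := Finset.univ.filter fun j => σ j ∈ A with hA'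
  have h2 := (abs_le.1 (abs_card_div_sub_le hx hgap)).2
  have hα : p₀ ≤ (A.card : ℝ) / N := by rwa [le_div_iff₀ hN0]
  -- Smallness of `ε` guarantees that the sample hits `A` at least `p₀ b / 2` times.
  have hα' : p₀ / 2 ≤ (A'.card : ℝ) / b := by linarith
  have hAc'b : p₀ / 2 * b ≤ A'.card := by rwa [le_div_iff₀ hb0] at hα'
  have hAc' : (0 : ℝ) < A'.card := (by positivity : 0 < p₀ / 2 * b).trans_le hAc'b
  have hne' : A'.Nonempty := Finset.card_pos.1 (by exact_mod_cast hAc')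
  refine (hq.2 A A' _ _ (2 * ε / p₀) hne hne' (fun i _ => hx i) (fun j _ => hx (σ j))
    (abs_cdf_sub_cdf_le hN hb hp₀ hA hne' hx hgap)).trans ?_
  rw [mul_assoc]
  refine mul_le_mul_of_nonneg_left ?_ hK
  have h3 : r * (1 / (A.card : ℝ) + 1 / A'.card) ≤ r * (3 / p₀ * (1 / b)) := by
    rcases hbN with rfl | hbN
    · simp
    · refine mul_le_mul_of_nonneg_left ?_ hr
      have hbN' : (b : ℝ) ≤ N := by exact_mod_cast hbN
      -- This is where `b ≤ N` enters: the rounding error of the full data set must be of order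
      -- `1/b`.
      have e1 : 1 / (A.card : ℝ) ≤ 1 / (p₀ * b) := one_div_le_one_div_of_le (by positivity)
        ((mul_le_mul_of_nonneg_left hbN' hp₀.le).trans hA)
      have e2 : 1 / (A'.card : ℝ) ≤ 1 / (p₀ / 2 * b) :=
        one_div_le_one_div_of_le (by positivity) hAc'b
      have e3 : 3 / p₀ * (1 / b) = 1 / (p₀ * b) + 1 / (p₀ / 2 * b) := by field_simp; norm_num
      linarith
  have h4 : 2 * ε / p₀ ≤ 3 / p₀ * ε := by
    rw [div_mul_eq_mul_div]; exact div_le_div_of_nonneg_right (by linarith) hp₀.le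
  linarith

lemma abs_loss_sub_sampleLoss_le {q : Multiset ℝ → ℝ} {l : ℝ → ℝ} {y : Fin N → ℝ} {r Q K Λ B : ℝ}
    (hr : 0 ≤ r) (hM : 0 ≤ M) (hK : 0 ≤ K) (hΛ : 0 ≤ Λ) (hB0 : 0 ≤ B)
    (hq : IsStable q r M Q K) (hB : ∀ u, |u| ≤ M + Q → |l u| ≤ B)
    (hlip : ∀ u v, |u| ≤ M + Q → |v| ≤ M + Q → |l u - l v| ≤ Λ * |u - v|)
    (hN : 0 < N) (hb : 0 < b) (hbN : r = 0 ∨ b ≤ N) (hp₀ : 0 < p₀) (hA : p₀ * N ≤ A.card)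
    (hx : ∀ i, |inner ℝ w (x i)| ≤ M) (hy : ∀ i, |y i| ≤ 1)
    (hgap : ∀ t, |massGap x (fun i => if i ∈ A then 1 else 0) σ w t| ≤ ε)
    (hgapy : ∀ t, |massGap x (fun i => 1 - y i) σ w t| ≤ ε) :
    |loss q l x y A w - sampleLoss q l x y A σ w| ≤
      (B + 2 * M * Λ + 2 * Λ * (K * (3 / p₀)) + 8 * B / p₀) * (ε + r * (1 / b)) := by
  have hε0 : 0 ≤ ε := (abs_nonneg _).trans (hgap 0)
  have hrb : 0 ≤ r * (1 / (b : ℝ)) := by positivity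
  set A' := Finset.univ.filter fun j => σ j ∈ A with hA'
  set q₀ := q (A.val.map fun i => inner ℝ w (x i)) with hq₀
  set q₁ := q (A'.val.map fun j => inner ℝ w (x (σ j))) with hq₁
  have hq₀Q : |q₀| ≤ Q := hq.1 A _ fun i _ => hx i
  have hq₁Q : |q₁| ≤ Q := hq.1 A' _ fun j _ => hx (σ j)
  -- For large `ε` the sample may miss `A`, but the trivial bound `4B` on the difference is enough.
  rcases le_or_gt (p₀ / 2) ε with hbig | hsmall
  · have h1 : |loss q l x y A w| ≤ 2 * B := abs_loss_le hB0 hx hy hq₀Q hB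
    have h2 : |sampleLoss q l x y A σ w| ≤ 2 * B :=
      abs_loss_le hB0 (fun j => hx (σ j)) (fun j => hy (σ j)) hq₁Q hB
    have h3 : 4 * B ≤ 8 * B / p₀ * ε := by
      rw [div_mul_eq_mul_div, le_div_iff₀ hp₀]
      nlinarith
    have h4 : 8 * B / p₀ * ε ≤
        (B + 2 * M * Λ + 2 * Λ * (K * (3 / p₀)) + 8 * B / p₀) * (ε + r * (1 / b)) := by
      refine mul_le_mul ?_ (by linarith) hε0 (by positivity)
      have : 0 ≤ B + 2 * M * Λ + 2 * Λ * (K * (3 / p₀)) := by positivity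
      linarith
    exact (abs_sub _ _).trans (by linarith)
  have hqq := abs_estimator_sub_le hr hK hq hN hb hbN hp₀ hA hx hgap hsmall
  rw [← hA', ← hq₀, ← hq₁] at hqq
  have harg : ∀ i (a : ℝ), |a| ≤ Q → |inner ℝ w (x i) - a| ≤ M + Q := fun i a ha =>
    (abs_sub _ _).trans (add_le_add (hx i) ha)
  -- Intermediate loss: sample average with the population threshold. The step from `loss` to `T`
  -- uses Abel summation with weights `1 - y`; the step from `T` to `sampleLoss` uses the Lipschitz
  -- bound on `l`.
  let T : ℝ := (1 / (b : ℝ)) * ∑ j, (1 - y (σ j)) * l (inner ℝ w (x (σ j)) - q₀)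
  have h1 : |loss q l x y A w - T| ≤ (B + 2 * M * Λ) * ε := by
    have hnet : ∀ v, |v| ≤ M → |v - q₀| ≤ M + Q := fun v hv =>
      (abs_sub _ _).trans (add_le_add hv hq₀Q)
    have := abs_sum_sub_sum_le Finset.univ Finset.univ (fun i => inner ℝ w (x i))
      (fun i => (1 / (N : ℝ)) * (1 - y i)) (fun j => inner ℝ w (x (σ j)))
      (fun j => (1 / (b : ℝ)) * (1 - y (σ j))) (fun v => l (v - q₀)) (fun v => Λ * v) hM
      (fun i _ => hx i) (fun j _ => hx (σ j)) (ε := ε) (by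
        intro p q hp hpq hq
        refine (hlip _ _ (hnet p (abs_le.2 ⟨hp, hpq.trans hq⟩))
          (hnet q (abs_le.2 ⟨hp.trans hpq, hq⟩))).trans (le_of_eq ?_)
        rw [sub_sub_sub_cancel_right, abs_sub_comm, abs_of_nonneg (sub_nonneg.2 hpq), mul_sub])
      (by
        intro t
        have := hgapy t
        simpa only [massGap, Finset.mul_sum, mul_ite, mul_zero] using this)
    have e1 : loss q l x y A w - T =
        (∑ i, 1 / (N : ℝ) * (1 - y i) * l (inner ℝ w (x i) - q₀)) -
          ∑ j, 1 / (b : ℝ) * (1 - y (σ j)) * l (inner ℝ w (x (σ j)) - q₀) := by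
      simp only [loss, T, Finset.mul_sum, mul_assoc, hq₀]
    rw [e1]
    refine this.trans (mul_le_mul_of_nonneg_right ?_ hε0)
    have := hB _ (hnet M (by rw [abs_of_nonneg hM]))
    linarith
  have h2 : |T - sampleLoss q l x y A σ w| ≤ 2 * (Λ * |q₀ - q₁|) := by
    have e1 : T - sampleLoss q l x y A σ w = (1 / ((Finset.univ : Finset (Fin b)).card : ℝ)) *
        ∑ j, (1 - y (σ j)) * (l (inner ℝ w (x (σ j)) - q₀) - l (inner ℝ w (x (σ j)) - q₁)) := by
      rw [Finset.card_univ, Fintype.card_fin]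
      simp only [mul_sub, Finset.sum_sub_distrib]
      rfl
    rw [e1]
    refine abs_mean_le _ _ (by positivity) fun j _ => ?_
    rw [abs_mul]
    have hyj := abs_le.1 (hy (σ j))
    refine mul_le_mul (abs_le.2 ⟨by linarith, by linarith⟩)
      ((hlip _ _ (harg _ _ hq₀Q) (harg _ _ hq₁Q)).trans (le_of_eq ?_)) (abs_nonneg _) (by norm_num)
    rw [sub_sub_sub_cancel_left, abs_sub_comm]
  have h3 := (abs_sub_le _ _ _).trans (add_le_add h1 h2)
  refine h3.trans ?_
  have h4 : 2 * (Λ * |q₀ - q₁|) ≤ 2 * (Λ * (K * (3 / p₀) * (ε + r * (1 / b)))) := by gcongr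
  have h5 : 0 ≤ (B + 2 * M * Λ) * (r * (1 / b)) := by positivity
  have h6 : 0 ≤ 8 * B / p₀ * (ε + r * (1 / b)) := by positivity
  linarith

end Deviation

/-! ### Sampling laws and the final probability bound -/

lemma IsSampleLaw.exists_finset {N b : ℕ} (hN : 0 < N) {P : Measure (Fin b → Fin N)}
    (hP : IsSampleLaw P) : ∃ I : Finset (Fin b → Fin N), I.Nonempty ∧
      (I = Finset.univ ∨ ∀ τ, τ ∈ I ↔ Function.Injective τ) ∧
      P = uniformOn (I : Set (Fin b → Fin N)) := by
  classical
  rcases hP with rfl | ⟨hbN, rfl⟩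
  · have : Nonempty (Fin N) := ⟨⟨0, hN⟩⟩
    refine ⟨Finset.univ, Finset.univ_nonempty, Or.inl rfl, ?_⟩
    rw [iidLaw, ← uniformOn_pi, Set.pi_univ, Finset.coe_univ]
  · refine ⟨Finset.univ.filter Function.Injective, ⟨Fin.castLE hbN, ?_⟩, Or.inr (by simp), ?_⟩
    · simpa using Fin.castLE_injective hbN
    · simp [noReplacementLaw]

/-- The deviation bound for every estimator that is stable on the range of scores. -/
lemma exists_le_measureReal_closeEvent (d : ℕ) {C R p₀ δ₀ : ℝ} (hp₀ : 0 < p₀) (hδ₀ : δ₀ < 1)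
    {l : ℝ → ℝ} (hl : LocallyLipschitz l) {q : Multiset ℝ → ℝ} {r : ℝ} (hr : 0 ≤ r)
    (hq : ∃ Q K : ℝ, 0 ≤ Q ∧ 0 ≤ K ∧ IsStable q r (|C| * |R|) Q K) :
    ∃ K : ℝ, ∀ (N b : ℕ), 0 < N → 0 < b → (r = 0 ∨ b ≤ N) →
      ∀ P : Measure (Fin b → Fin N), IsSampleLaw P →
      ∀ (x : Fin N → EuclideanSpace ℝ (Fin d)) (y : Fin N → ℝ) (A : Finset (Fin N)),
        (∀ i, ‖x i‖ ≤ R) → (∀ i, |y i| ≤ 1) → p₀ * N ≤ A.card →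
        ∀ δ : ℝ, 0 < δ → δ ≤ δ₀ →
          1 - δ ≤ P.real (closeEvent b q l x y A C (K * √(1 / b * Real.log (1 / δ)))) := by
  classical
  obtain ⟨Q, Kq, hQ, hKq, hstab⟩ := hq
  set M := |C| * |R| with hM
  have hM0 : 0 ≤ M := by positivity
  obtain ⟨Λ, B, hΛ, hB0, hB, hlip⟩ := exists_lipschitz_bound hl (add_nonneg hM0 hQ)
  obtain ⟨K₀, hK₀, hdev⟩ := exists_card_massGap_le d (B := 2) (by norm_num) hδ₀
  rcases le_or_gt δ₀ 0 with hneg | hδ₀pos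
  · exact ⟨0, fun _ _ _ _ _ _ _ _ _ _ _ _ _ δ h1 h2 => by linarith⟩
  set ℓ := Real.log (1 / δ₀) with hℓ
  have hℓpos : 0 < ℓ := Real.log_pos (by rw [lt_div_iff₀ hδ₀pos]; linarith)
  set K₁ := B + 2 * M * Λ + 2 * Λ * (Kq * (3 / p₀)) + 8 * B / p₀ with hK₁
  have hK₁0 : 0 ≤ K₁ := by positivity
  refine ⟨K₁ * (K₀ + r / √ℓ), ?_⟩
  intro N b hN hb hbN P hP x y A hx hy hA δ hδ hδδ₀
  have hb0 : (0 : ℝ) < b := by exact_mod_cast hb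
  have hb1 : (1 : ℝ) ≤ b := by exact_mod_cast hb
  have hqℓ : ℓ ≤ Real.log (1 / δ) :=
    Real.log_le_log (by positivity) (one_div_le_one_div_of_le hδ hδδ₀)
  set ρ := √(1 / b * Real.log (1 / δ)) with hρ
  -- Rounding errors `1/b` are dominated by the rate because `log (1/δ) ≥ ℓ > 0`.
  have hinv : 1 / (b : ℝ) ≤ 1 / √ℓ * ρ := by
    rw [one_div_mul_eq_div, le_div_iff₀ (Real.sqrt_pos.2 hℓpos), hρ]
    refine Real.le_sqrt_of_sq_le ?_
    rw [mul_pow, Real.sq_sqrt hℓpos.le]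
    refine mul_le_mul ?_ hqℓ hℓpos.le (by positivity)
    have : 1 / (b : ℝ) ≤ 1 := by rw [div_le_one hb0]; exact hb1
    nlinarith [show 0 < 1 / (b : ℝ) by positivity]
  obtain ⟨I, hne, hI, rfl⟩ := hP.exists_finset hN
  have hbad₁ := hdev hN hb x (fun i => if i ∈ A then 1 else 0)
    (fun i => by split_ifs <;> norm_num) I hne hI hδ hδδ₀
  have hbad₂ := hdev hN hb x (fun i => 1 - y i)
    (fun i => by
      have := abs_le.1 (hy i)
      exact abs_le.2 ⟨by linarith, by linarith⟩) I hne hI hδ hδδ₀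
  rw [← hρ] at hbad₁ hbad₂
  set J₁ := I.filter fun σ => ¬ ∀ w t, |massGap x (fun i => if i ∈ A then 1 else 0) σ w t| ≤ K₀ * ρ
  set J₂ := I.filter fun σ => ¬ ∀ w t, |massGap x (fun i => 1 - y i) σ w t| ≤ K₀ * ρ
  set E := closeEvent b q l x y A C (K₁ * (K₀ + r / √ℓ) * ρ) with hE
  -- Union bound over the two weight functions, each failing on a fraction at most `δ / 2` of the
  -- samples.
  have hgood : I ⊆ (I ∩ E.toFinset) ∪ (J₁ ∪ J₂) := by
    intro σ hσ
    by_cases h₁ : σ ∈ J₁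
    · simp [h₁]
    by_cases h₂ : σ ∈ J₂
    · simp [h₂]
    have g₁ : ∀ w t, |massGap x (fun i => if i ∈ A then 1 else 0) σ w t| ≤ K₀ * ρ := by
      by_contra h
      exact h₁ (Finset.mem_filter.2 ⟨hσ, h⟩)
    have g₂ : ∀ w t, |massGap x (fun i => 1 - y i) σ w t| ≤ K₀ * ρ := by
      by_contra h
      exact h₂ (Finset.mem_filter.2 ⟨hσ, h⟩)
    refine Finset.mem_union_left _ (Finset.mem_inter.2 ⟨hσ, Set.mem_toFinset.2 ?_⟩)
    intro w hw
    have hxw : ∀ i, |inner ℝ w (x i)| ≤ M := fun i =>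
      (abs_real_inner_le_norm _ _).trans (mul_le_mul (hw.trans (le_abs_self _))
        ((hx i).trans (le_abs_self _)) (norm_nonneg _) (abs_nonneg _))
    refine (abs_loss_sub_sampleLoss_le hr hM0 hKq hΛ hB0 hstab hB hlip hN hb hbN hp₀ hA hxw hy
      (g₁ w) (g₂ w)).trans ?_
    rw [mul_assoc K₁]
    refine mul_le_mul_of_nonneg_left ?_ hK₁0
    have := mul_le_mul_of_nonneg_left hinv hr
    calc K₀ * ρ + r * (1 / b) ≤ K₀ * ρ + r * (1 / √ℓ * ρ) := by linarith
      _ = (K₀ + r / √ℓ) * ρ := by ring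
  have hcard : (I.card : ℝ) ≤ (I ∩ E.toFinset).card + (J₁.card + J₂.card) := by
    have := (Finset.card_le_card hgood).trans ((Finset.card_union_le _ _).trans
      (Nat.add_le_add_left (Finset.card_union_le _ _) _))
    exact_mod_cast this
  have hIpos : (0 : ℝ) < I.card := by exact_mod_cast hne.card_pos
  have hreal : (uniformOn (I : Set (Fin b → Fin N))).real E = (I ∩ E.toFinset).card / I.card := by
    rw [measureReal_def]
    conv_lhs => rw [← Set.coe_toFinset E]
    rw [uniformOn_apply_finset, ENNReal.toReal_div]
    simp
  rw [hreal, le_div_iff₀ hIpos]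
  linarith

end QuantileLoss

theorem mainTheorem1 (d : ℕ) (C R p₀ δ₀ : ℝ) (hp₀ : 0 < p₀) (hδ₀ : δ₀ < 1)
    (l : ℝ → ℝ) (hl : LocallyLipschitz l) :
    -- the kernel quantile estimator
    (∀ (φ : ℝ → ℝ) (h c : ℝ), (∃ M : ℝ, ∀ t, |φ t| ≤ M) → (∃ M : NNReal, LipschitzWith M φ) →
      0 < h →
      ∃ K : ℝ, ∀ (N b : ℕ), 0 < N → 0 < b →
        ∀ P : Measure (Fin b → Fin N), QuantileLoss.IsSampleLaw P →
        ∀ (x : Fin N → EuclideanSpace ℝ (Fin d)) (y : Fin N → ℝ) (A : Finset (Fin N)),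
          (∀ i, ‖x i‖ ≤ R) → (∀ i, |y i| ≤ 1) → p₀ * N ≤ A.card →
          ∀ δ : ℝ, 0 < δ → δ ≤ δ₀ →
            1 - δ ≤ P.real (QuantileLoss.closeEvent b (QuantileLoss.kernelEstimator φ h c)
              l x y A C (K * √(1 / b * Real.log (1 / δ))))) ∧
    -- the interval quantile estimator
    (∀ k₁ k₂ : ℝ, 0 < k₁ → k₁ < k₂ → k₂ ≤ 1 →
      ∃ K : ℝ, ∀ (N b : ℕ), 0 < N → 0 < b → b ≤ N →
        ∀ P : Measure (Fin b → Fin N), QuantileLoss.IsSampleLaw P →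
        ∀ (x : Fin N → EuclideanSpace ℝ (Fin d)) (y : Fin N → ℝ) (A : Finset (Fin N)),
          (∀ i, ‖x i‖ ≤ R) → (∀ i, |y i| ≤ 1) → p₀ * N ≤ A.card →
          ∀ δ : ℝ, 0 < δ → δ ≤ δ₀ →
            1 - δ ≤ P.real (QuantileLoss.closeEvent b (QuantileLoss.intervalEstimator k₁ k₂)
              l x y A C (K * √(1 / b * Real.log (1 / δ))))) := by
  have hM : 0 ≤ |C| * |R| := by positivity
  refine ⟨fun φ h c ⟨B, hB⟩ ⟨Λ, hΛ⟩ hh => ?_, fun k₁ k₂ h1 h12 h2 => ?_⟩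
  · obtain ⟨K, hK⟩ := QuantileLoss.exists_le_measureReal_closeEvent d (C := C) (R := R) hp₀ hδ₀ hl
      le_rfl (QuantileLoss.kernelEstimator_isStable c hh hB hΛ hM)
    exact ⟨K, fun N b hN hb => hK N b hN hb (Or.inl rfl)⟩
  · obtain ⟨K, hK⟩ := QuantileLoss.exists_le_measureReal_closeEvent d (C := C) (R := R) hp₀ hδ₀ hl
      zero_le_one (QuantileLoss.intervalEstimator_isStable h1 h12 h2 hM)
    exact ⟨K, fun N b hN hb hbN => hK N b hN hb (Or.inr hbN)⟩
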